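/- Let $h:\mathbb{R}\to\mathbb{R}$ be an even $C^2$ function with $h(0)=h'(0)=h''(0)=0$ whose second derivative $h''$ is strictly increasing, unbounded and concave on $[0,\infty)$. The unbounded forecasting game with quadratic and stronger hedges (UFQSH) with parameter $h$ is the following perfect-information game between Forecaster, Skeptic and Reality. Put $\mathcal{K}_0=1$. In each round $n=1,2,\ldots$, Forecaster announces $m_n\in\mathbb{R}$, $v_n\ge 0$ and $w_n\ge 0$; then Skeptic announces $M_n,V_n,W_n\in\mathbb{R}$; then Reality announces $x_n\in\mathbb{R}$; and Skeptic's capital becomes \[ \mathcal{K}_n=\mathcal{K}_{n-1}+M_n(x_n-m_n)+V_n\bigl((x_n-m_n)^2-v_n\bigr)+W_n\bigl(h(x_n-m_n)-w_n\bigr). \] Forecaster must keep the game coherent: in every round $n$, for all $M,V,W\in\mathbb{R}$ there is $x\in\mathbb{R}$ with $M(x-m_n)+V((x-m_n)^2-v_n)+W(h(x-m_n)-w_n)\le 0$. Skeptic can force an event $E$ (a set of infinite sequences of moves of Forecaster and Reality) if he has a strategy, in which each move depends only on the earlier moves of Forecaster and Reality and on Forecaster's move in the current round, that keeps $\mathcal{K}_n\ge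 0$ for all $n$ whatever the other players do, and such that $E$ happens whenever Forecaster keeps the game coherent and $\mathcal{K}_n$ does not tend to $+\infty$. Let $A_n=\sum_{i=1}^n v_i$, $S_n=\sum_{i=1}^n x_i$ and $b_n=\sqrt{A_n/\ln\ln A_n}$. Theorem. In UFQSH with such an $h$, Skeptic can force \[ \Bigl(A_n\to\infty\ \text{ and }\ \sum_n\frac{w_n}{h(b_n)}<\infty\Bigr)\ \Longrightarrow\ \limsup_{n\to\infty}\frac{S_n-\sum_{i=1}^n m_i}{\sqrt{2A_n\ln\ln A_n}}=1 . \] (Here the series is taken over the $n$ with $A_n>e$; when $A_n\to\infty$ this omits only finitely many terms.) -/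

import Mathlib

open Filter Topology

noncomputable section

namespace UFQSH

/-- The conditions on the extra hedge `h`: it is even, twice continuously differentiable, vanishes
at `0` together with its first two derivatives, and its second derivative is strictly increasing,
unbounded and concave on `[0, ∞)`. -/
structure IsExtraHedge (h : ℝ → ℝ) : Prop where
  even : ∀ x, h (-x) = h x
  contDiff : ContDiff ℝ 2 h
  zero : h 0 = 0
  deriv_zero : deriv h 0 = 0
  deriv_deriv_zero : deriv (deriv h) 0 = 0
  strictMonoOn : StrictMonoOn (deriv (deriv h)) (Set.Ici 0)
  unbounded : ¬ BddAbove (deriv (deriv h) '' Set.Ici 0)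
  concaveOn : ConcaveOn ℝ (Set.Ici 0) (deriv (deriv h))

/-- A move of Forecaster: the price `m` of `x`, the price `v ≥ 0` of the quadratic hedge
`(x - m) ^ 2`, and the price `w ≥ 0` of the extra hedge `h (x - m)`. -/
structure Forecast where
  m : ℝ
  v : ℝ
  w : ℝ
  v_nonneg : 0 ≤ v
  w_nonneg : 0 ≤ w

/-- A move of Skeptic: three real numbers of arbitrary sign. -/
structure Stake where
  M : ℝ
  V : ℝ
  W : ℝ

/-- The change of Skeptic's capital in one round. -/
def gain (h : ℝ → ℝ) (f : Forecast) (s : Stake) (x : ℝ) : ℝ :=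
  s.M * (x - f.m) + s.V * ((x - f.m) ^ 2 - f.v) + s.W * (h (x - f.m) - f.w)

/-- A forecast is coherent if, whatever Skeptic's move, Reality has a move that does not increase
Skeptic's capital. -/
def Forecast.IsCoherent (h : ℝ → ℝ) (f : Forecast) : Prop :=
  ∀ s : Stake, ∃ x : ℝ, gain h f s x ≤ 0

/-- A path: the infinite sequences of moves of Forecaster and of Reality. The rounds are numbered
from `0`. -/
structure Path where
  forecast : ℕ → Forecast
  outcome : ℕ → ℝ

/-- The moves of Forecaster and Reality in the first `n` rounds. -/
def Path.history (ω : Path) (n : ℕ) : Fin n → Forecast × ℝ :=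
  fun i => (ω.forecast i, ω.outcome i)

/-- A strategy of Skeptic: his move in a round is determined by the moves of Forecaster and Reality
in the `n` preceding rounds and by Forecaster's move in the current round. -/
def Strategy : Type := (n : ℕ) → (Fin n → Forecast × ℝ) → Forecast → Stake

/-- Skeptic's capital after `n` rounds, with initial capital `1`. -/
def capital (h : ℝ → ℝ) (σ : Strategy) (ω : Path) : ℕ → ℝ
  | 0 => 1
  | n + 1 => capital h σ ω n
      + gain h (ω.forecast n) (σ n (ω.history n) (ω.forecast n)) (ω.outcome n)

/-- Skeptic can force the event `E`: he has a strategy that keeps his capital nonnegative whatever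
the other players do, and such that, if Forecaster keeps the game coherent and Reality keeps
Skeptic's capital from tending to infinity, then `E` happens. -/
def SkepticCanForce (h : ℝ → ℝ) (E : Set Path) : Prop :=
  ∃ σ : Strategy, (∀ (ω : Path) (n : ℕ), 0 ≤ capital h σ ω n) ∧
    ∀ ω : Path, (∀ n, (ω.forecast n).IsCoherent h) →
      ¬ Tendsto (capital h σ ω) atTop atTop → ω ∈ E

/-- `A_n`, the sum of the first `n` variance prices. -/
def Path.A (ω : Path) (n : ℕ) : ℝ := ∑ i ∈ Finset.range n, (ω.forecast i).v

/-- `S_n`, the sum of the first `n` moves of Reality. -/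
def Path.S (ω : Path) (n : ℕ) : ℝ := ∑ i ∈ Finset.range n, ω.outcome i

/-- `b_n = √(A_n / ln ln A_n)`; it is meaningful as soon as `A_n > e`. -/
def Path.b (ω : Path) (n : ℕ) : ℝ := √(ω.A n / Real.log (Real.log (ω.A n)))

end UFQSH

end

/-! Skeptic bets a fixed multiple of his capital: with `M = l K` and `V = l ^ 2 K / 2` a round
multiplies the capital by `factor l y v`, where `y = x - m`. This equals `exp (l y - l ^ 2 v / 2)`
up to an error in the exponent that is cubic in `l y` and `l √v` (`exp_le_quadratic_le_exp`). So
products of factors imitate the exponential martingales of the classical proof of the law of the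
iterated logarithm, with multipliers of order `1 / b`.

The cubic errors are summable. Monotonicity and concavity of `h''` place `h` between quadratic and
cubic scaling, so `(|y| / b) ^ 3 ≤ h y / h b` for `|y| ≤ b`. Skeptic forces the payoffs `h y / h b`
to be summable when the prices `w / h b` are, and coherence bounds `v` through `h (√(v / 2)) ≤ w`
(`summable_err`).

Upper bound (`forceable_upper`): one account for each level `(1 + η) ^ k` of the variance, with the
optimal multiplier for that level and a weight of order `k ^ -(1 + η / 2)`. Each time the deviation
is too large, the account of the current level earns back its weight; infinitely many such accounts
make the mixture infinite.

Lower bound (`forceable_lower`): for a large `q`, let `E₁` and `E₂` be the products of factors over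
the block where `A` lies in `[q ^ k, q ^ (k + 1))`, with the optimal multiplier `l` and with `(1 -
η) l`. Skeptic holds `p (E₂ - 2 E₁)` with `p = 1 / log (q ^ (k + 1))`, which starts at `-p`. If the
deviations stay too small, `p E₁` stays small during the block and `2 E₁ ≤ E₂` at its end, so the
block earns at least `p`; the sum of the `p` diverges harmonically. The short position in `E₁` loses
quadratically on large outcomes, and a long position in the extra hedge covers that loss at a small
total price.

All estimates hold only from an unknown round on, so Skeptic mixes strategies over all starting
rounds (`forceable_of_seq`). -/

noncomputable section

namespace UFQSH

/-! ### Growth of the extra hedge -/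

/-- A function on `[0, ∞)` with zero value and slope at `0` and nonnegative second derivative is
nonnegative. -/
lemma nonneg_of_deriv2_nonneg {f f' f'' : ℝ → ℝ} (hf : ∀ x, HasDerivAt f (f' x) x)
    (hf' : ∀ x, HasDerivAt f' (f'' x) x) (h0 : f 0 = 0) (h0' : f' 0 = 0)
    (h2 : ∀ x, 0 ≤ x → 0 ≤ f'' x) {x : ℝ} (hx : 0 ≤ x) : 0 ≤ f x := by
  have m1 : MonotoneOn f' (Set.Ici 0) := by
    apply monotoneOn_of_deriv_nonneg (convex_Ici 0)
    · exact fun y _ => (hf' y).continuousAt.continuousWithinAt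
    · exact fun y _ => (hf' y).differentiableAt.differentiableWithinAt
    · intro y hy
      rw [interior_Ici, Set.mem_Ioi] at hy
      rw [(hf' y).deriv]
      exact h2 y hy.le
  have m0 : MonotoneOn f (Set.Ici 0) := by
    apply monotoneOn_of_deriv_nonneg (convex_Ici 0)
    · exact fun y _ => (hf y).continuousAt.continuousWithinAt
    · exact fun y _ => (hf y).differentiableAt.differentiableWithinAt
    · intro y hy
      rw [interior_Ici, Set.mem_Ioi] at hy
      rw [(hf y).deriv, ← h0']
      exact m1 Set.self_mem_Ici hy.le hy.le
  rw [← h0]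
  exact m0 Set.self_mem_Ici hx hx

namespace IsExtraHedge

variable {h : ℝ → ℝ} (hh : IsExtraHedge h)

include hh

lemma hasDerivAt (x : ℝ) : HasDerivAt h (deriv h x) x :=
  (hh.contDiff.differentiable (by norm_num) x).hasDerivAt

lemma hasDerivAt_deriv (x : ℝ) : HasDerivAt (deriv h) (deriv (deriv h) x) x := by
  have h1 : ContDiff ℝ 1 (deriv h) := by
    have := hh.contDiff
    rw [show (2 : WithTop ℕ∞) = 1 + 1 by norm_num, contDiff_succ_iff_deriv] at this
    exact this.2.2
  exact (h1.differentiable (by norm_num) x).hasDerivAt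

lemma hasDerivAt_scale (t x : ℝ) : HasDerivAt (fun x => h (t * x)) (t * deriv h (t * x)) x := by
  have := (hh.hasDerivAt (t * x)).comp x ((hasDerivAt_id x).const_mul t)
  simpa [mul_comm, Function.comp_def] using this

lemma hasDerivAt_scale_deriv (t x : ℝ) :
    HasDerivAt (fun x => t * deriv h (t * x)) (t ^ 2 * deriv (deriv h) (t * x)) x := by
  have := ((hh.hasDerivAt_deriv (t * x)).comp x ((hasDerivAt_id x).const_mul t)).const_mul t
  exact this.congr_deriv (by ring)

lemma apply_abs (x : ℝ) : h |x| = h x := by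
  rcases abs_choice x with e | e <;> rw [e]
  exact hh.even x

/-- Monotonicity of `h''` compares the second derivatives in `x` of the two sides. -/
lemma apply_mul_le {t : ℝ} (t0 : 0 ≤ t) (t1 : t ≤ 1) (x : ℝ) : h (t * x) ≤ t ^ 2 * h x := by
  have key : ∀ x, 0 ≤ x → h (t * x) ≤ t ^ 2 * h x := by
    intro x hx
    have := nonneg_of_deriv2_nonneg (f := fun x => t ^ 2 * h x - h (t * x))
      (fun x => ((hh.hasDerivAt x).const_mul (t ^ 2)).sub (hh.hasDerivAt_scale t x))
      (fun x => ((hh.hasDerivAt_deriv x).const_mul (t ^ 2)).sub (hh.hasDerivAt_scale_deriv t x))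
      (by simp [hh.zero]) (by simp [hh.deriv_zero])
      (fun x hx => by
        have : deriv (deriv h) (t * x) ≤ deriv (deriv h) x :=
          hh.strictMonoOn.monotoneOn (Set.mem_Ici.2 (by positivity)) hx
            (mul_le_of_le_one_left hx t1)
        rw [← mul_sub]
        exact mul_nonneg (by positivity) (sub_nonneg.2 this)) hx
    linarith
  have := key |x| (abs_nonneg x)
  rwa [hh.apply_abs, ← abs_of_nonneg t0, ← abs_mul, hh.apply_abs, abs_of_nonneg t0] at this

/-- Concavity of `h''` and `h'' 0 = 0` give `t * h'' x ≤ h'' (t * x)`, hence the third power. -/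
lemma le_apply_mul {t : ℝ} (t0 : 0 ≤ t) (t1 : t ≤ 1) (x : ℝ) : t ^ 3 * h x ≤ h (t * x) := by
  have key : ∀ x, 0 ≤ x → t ^ 3 * h x ≤ h (t * x) := by
    intro x hx
    have := nonneg_of_deriv2_nonneg (f := fun x => h (t * x) - t ^ 3 * h x)
      (fun x => (hh.hasDerivAt_scale t x).sub ((hh.hasDerivAt x).const_mul (t ^ 3)))
      (fun x => (hh.hasDerivAt_scale_deriv t x).sub ((hh.hasDerivAt_deriv x).const_mul (t ^ 3)))
      (by simp [hh.zero]) (by simp [hh.deriv_zero])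
      (fun x hx => by
        have := hh.concaveOn.2 (Set.mem_Ici.2 hx) (Set.self_mem_Ici (a := (0 : ℝ))) t0
          (sub_nonneg.2 t1) (by ring)
        simp only [smul_eq_mul, hh.deriv_deriv_zero, mul_zero, add_zero] at this
        have := mul_le_mul_of_nonneg_left this (sq_nonneg t)
        linarith) hx
    linarith
  have := key |x| (abs_nonneg x)
  rwa [hh.apply_abs, ← abs_of_nonneg t0, ← abs_mul, hh.apply_abs, abs_of_nonneg t0] at this

lemma pos {x : ℝ} (hx : x ≠ 0) : 0 < h x := by
  have g : ∀ x, 0 < x → 0 < deriv (deriv h) x := fun x hx => by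
    rw [← hh.deriv_deriv_zero]
    exact hh.strictMonoOn Set.self_mem_Ici hx.le hx
  have m1 : StrictMonoOn (deriv h) (Set.Ici 0) := by
    apply strictMonoOn_of_deriv_pos (convex_Ici 0)
    · exact fun y _ => (hh.hasDerivAt_deriv y).continuousAt.continuousWithinAt
    · intro y hy
      rw [interior_Ici] at hy
      exact g y hy
  have m0 : StrictMonoOn h (Set.Ici 0) := by
    apply strictMonoOn_of_deriv_pos (convex_Ici 0)
    · exact fun y _ => (hh.hasDerivAt y).continuousAt.continuousWithinAt
    · intro y hy
      rw [interior_Ici] at hy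
      rw [← hh.deriv_zero]
      exact m1 Set.self_mem_Ici (Set.mem_Ici.2 (le_of_lt hy)) hy
  rw [← hh.apply_abs, ← hh.zero]
  exact m0 Set.self_mem_Ici (abs_nonneg x) (abs_pos.2 hx)

lemma nonneg (x : ℝ) : 0 ≤ h x := by
  rcases eq_or_ne x 0 with rfl | hx
  · exact hh.zero.ge
  · exact (hh.pos hx).le

lemma mono_abs {x y : ℝ} (hxy : |x| ≤ |y|) : h x ≤ h y := by
  rcases eq_or_ne y 0 with rfl | hy
  · simp only [abs_zero, abs_nonpos_iff] at hxy
    rw [hxy]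
  have hy' : 0 < |y| := abs_pos.2 hy
  have h1 : |x| / |y| ≤ 1 := (div_le_one hy').2 hxy
  have := hh.apply_mul_le (t := |x| / |y|) (by positivity) h1 |y|
  rw [div_mul_cancel₀ _ hy'.ne', hh.apply_abs, hh.apply_abs] at this
  refine this.trans (mul_le_of_le_one_left (hh.nonneg y) ?_)
  exact pow_le_one₀ (by positivity) h1

lemma cube_le {y B : ℝ} (hB : 0 < B) (hy : |y| ≤ B) : (|y| / B) ^ 3 ≤ h y / h B := by
  have := hh.le_apply_mul (t := |y| / B) (by positivity) ((div_le_one hB).2 hy) B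
  rw [div_mul_cancel₀ _ hB.ne', hh.apply_abs] at this
  rwa [le_div_iff₀ (hh.pos hB.ne')]

lemma abs_lt_of_ratio_lt {y B ε : ℝ} (hB : 0 < B) (ε0 : 0 < ε) (ε1 : ε ≤ 1)
    (hy : h y / h B < ε ^ 3) : |y| < ε * B := by
  by_contra! hc
  have h1 : h (ε * B) ≤ h y := hh.mono_abs (by rwa [abs_of_pos (by positivity)])
  have h2 := hh.le_apply_mul ε0.le ε1 B
  rw [div_lt_iff₀ (hh.pos hB.ne')] at hy
  linarith

lemma sq_le {x B D : ℝ} (hB : 0 < B) (hD : 1 ≤ D) (hx : B ≤ D * |x|) :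
    (x / B) ^ 2 ≤ D * (h x / h B) := by
  have hBp := hh.pos hB.ne'
  have hx0 : 0 < |x| := by
    by_contra! hc
    nlinarith
  have hr : 0 ≤ h x / h B := div_nonneg (hh.nonneg x) hBp.le
  have e : (x / B) ^ 2 = (|x| / B) ^ 2 := by rw [div_pow, div_pow, sq_abs]
  rcases le_total B |x| with hc | hc
  · have h1 := hh.apply_mul_le (t := B / |x|) (by positivity) ((div_le_one hx0).2 hc) |x|
    rw [div_mul_cancel₀ _ hx0.ne', hh.apply_abs] at h1
    have h2 : (|x| / B) ^ 2 ≤ h x / h B := by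
      rw [le_div_iff₀ hBp]
      calc (|x| / B) ^ 2 * h B ≤ (|x| / B) ^ 2 * ((B / |x|) ^ 2 * h x) := by gcongr
        _ = h x := by field_simp
    rw [e]
    nlinarith
  · have h1 := hh.cube_le hB hc
    have h2 : 1 ≤ D * (|x| / B) := by
      rw [← mul_div_assoc, one_le_div hB]
      exact hx
    rw [e]
    have h3 : 0 ≤ (|x| / B) ^ 2 := by positivity
    calc (|x| / B) ^ 2 ≤ (|x| / B) ^ 2 * (D * (|x| / B)) := le_mul_of_one_le_right h3 h2
      _ = D * (|x| / B) ^ 3 := by ring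
      _ ≤ D * (h x / h B) := by gcongr

/-- In a coherent game the price of the extra hedge dominates the variance price. -/
lemma apply_sqrt_le_of_isCoherent {f : Forecast} (hf : f.IsCoherent h) :
    h (√(f.v / 2)) ≤ f.w := by
  rcases f.v_nonneg.eq_or_lt with hv | hv
  · rw [← hv]
    simpa [hh.zero] using f.w_nonneg
  set s := √(f.v / 2) with hs
  have hs0 : 0 < s := Real.sqrt_pos.2 (by positivity)
  have hs2 : s ^ 2 = f.v / 2 := Real.sq_sqrt (by positivity)
  -- This stake earns at least `h s - w` whatever `x` is, because `h y ≥ h s / s ^ 2 * (y ^ 2 - s ^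
  -- 2)` and `v = 2 * s ^ 2`. The halving of `v` is what leaves the surplus `h s`.
  obtain ⟨x, hx⟩ := hf ⟨0, -(h s / s ^ 2), 1⟩
  simp only [gain, zero_mul, zero_add, one_mul] at hx
  set y := x - f.m
  have hkey : h s / s ^ 2 * (y ^ 2 - s ^ 2) ≤ h y := by
    rcases le_total |y| s with hc | hc
    · refine le_trans (mul_nonpos_of_nonneg_of_nonpos
        (div_nonneg (hh.nonneg s) (sq_nonneg s)) ?_) (hh.nonneg y)
      rw [← sq_abs y]
      have := abs_nonneg y
      nlinarith
    · have h1 := hh.sq_le (x := y) hs0 le_rfl (by simpa using hc)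
      rw [one_mul, div_pow, le_div_iff₀ (hh.pos hs0.ne')] at h1
      have : h s / s ^ 2 * s ^ 2 = h s := by field_simp
      have h3 := hh.nonneg s
      calc h s / s ^ 2 * (y ^ 2 - s ^ 2) = y ^ 2 / s ^ 2 * h s - h s := by field_simp
        _ ≤ h y := by linarith
  have e : h s / s ^ 2 * (y ^ 2 - f.v) = h s / s ^ 2 * (y ^ 2 - s ^ 2) - h s := by
    rw [show f.v = 2 * s ^ 2 by linarith]
    field_simp
    ring
  nlinarith

end IsExtraHedge

/-! ### Predictable stakes and the wealth they produce -/

/-- Two paths agree on what Skeptic knows when he moves in round `n`. -/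
def Path.AgreeAt (n : ℕ) (ω ω' : Path) : Prop :=
  (∀ i ≤ n, ω.forecast i = ω'.forecast i) ∧ ∀ i < n, ω.outcome i = ω'.outcome i

lemma Path.AgreeAt.mono {m n : ℕ} {ω ω' : Path} (h : Path.AgreeAt n ω ω') (hmn : m ≤ n) :
    Path.AgreeAt m ω ω' :=
  ⟨fun i hi => h.1 i (hi.trans hmn), fun i hi => h.2 i (hi.trans_le hmn)⟩

/-- A process that is determined by what Skeptic knows when he moves. -/
def Predictable {α : Type*} (s : ℕ → Path → α) : Prop :=
  ∀ n ω ω', Path.AgreeAt n ω ω' → s n ω = s n ω'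

/-- The stake that leaves the capital unchanged. -/
def noStake : Stake := ⟨0, 0, 0⟩

@[simp] lemma gain_noStake (h : ℝ → ℝ) (f : Forecast) (x : ℝ) : gain h f noStake x = 0 := by
  simp [gain, noStake]

/-- The capital, started at `1`, of a Skeptic who plays the stakes `s`. -/
def wealth (h : ℝ → ℝ) (s : ℕ → Path → Stake) (ω : Path) (n : ℕ) : ℝ :=
  1 + ∑ i ∈ Finset.range n, gain h (ω.forecast i) (s i ω) (ω.outcome i)

@[simp] lemma wealth_zero (h : ℝ → ℝ) (s : ℕ → Path → Stake) (ω : Path) : wealth h s ω 0 = 1 := by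
  simp [wealth]

lemma wealth_succ (h : ℝ → ℝ) (s : ℕ → Path → Stake) (ω : Path) (n : ℕ) :
    wealth h s ω (n + 1) = wealth h s ω n + gain h (ω.forecast n) (s n ω) (ω.outcome n) := by
  simp [wealth, Finset.sum_range_succ, add_assoc]

lemma wealth_of_null {h : ℝ → ℝ} {s : ℕ → Path → Stake} {r : ℕ} {ω : Path}
    (hs : ∀ n < r, s n ω = noStake) {n : ℕ} (hn : n ≤ r) : wealth h s ω n = 1 := by
  unfold wealth
  rw [Finset.sum_eq_zero, add_zero]
  intro i hi
  rw [hs i ((Finset.mem_range.1 hi).trans_le hn), gain_noStake]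

/-- The path that continues a history and a forecast in an arbitrary way. -/
def Path.ofHistory (n : ℕ) (p : Fin n → Forecast × ℝ) (f : Forecast) : Path where
  forecast i := if hi : i < n then (p ⟨i, hi⟩).1 else f
  outcome i := if hi : i < n then (p ⟨i, hi⟩).2 else 0

lemma Path.agreeAt_ofHistory (ω : Path) (n : ℕ) :
    Path.AgreeAt n (Path.ofHistory n (ω.history n) (ω.forecast n)) ω := by
  refine ⟨fun i hi => ?_, fun i hi => ?_⟩
  · rcases hi.lt_or_eq with hi | rfl
    · simp [Path.ofHistory, hi, Path.history]
    · simp [Path.ofHistory]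
  · simp [Path.ofHistory, hi, Path.history]

lemma exists_strategy (h : ℝ → ℝ) {s : ℕ → Path → Stake} (hs : Predictable s) :
    ∃ σ : Strategy, ∀ ω n, capital h σ ω n = wealth h s ω n := by
  refine ⟨fun n p f => s n (Path.ofHistory n p f), fun ω n => ?_⟩
  induction n with
  | zero => simp [capital]
  | succ n ih =>
    change capital h _ ω n + gain h (ω.forecast n) (s n _) (ω.outcome n) = _
    rw [ih, wealth_succ, hs n _ _ (ω.agreeAt_ofHistory n)]

/-! ### Forcing with stakes that start late -/

/-- Skeptic can make his capital tend to infinity outside `E` by predictable stakes that start as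
late as desired and keep the capital nonnegative. -/
def Forceable (h : ℝ → ℝ) (E : Set Path) : Prop :=
  ∀ r : ℕ, ∃ s : ℕ → Path → Stake, Predictable s ∧ (∀ n < r, ∀ ω, s n ω = noStake) ∧
    (∀ ω n, 0 ≤ wealth h s ω n) ∧ ∀ ω, ω ∉ E → Tendsto (wealth h s ω) atTop atTop

lemma Forceable.skepticCanForce {h : ℝ → ℝ} {E F : Set Path} (hE : Forceable h E)
    (hEF : ∀ ω ∈ E, (∀ n, (ω.forecast n).IsCoherent h) → ω ∈ F) : SkepticCanForce h F := by
  obtain ⟨s, hs, -, hn, ht⟩ := hE 0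
  obtain ⟨σ, hσ⟩ := exists_strategy h hs
  refine ⟨σ, fun ω n => (hσ ω n).symm ▸ hn ω n, fun ω hc hω => hEF ω ?_ hc⟩
  by_contra hE'
  exact hω ((ht ω hE').congr fun n => (hσ ω n).symm)

/-- The weighted sum of a family of stakes. -/
def mixture {ι : Type*} (c : ι → ℝ) (s : ι → ℕ → Path → Stake) (n : ℕ) (ω : Path) : Stake :=
  ⟨∑' j, c j * (s j n ω).M, ∑' j, c j * (s j n ω).V, ∑' j, c j * (s j n ω).W⟩

lemma predictable_mixture {ι : Type*} (c : ι → ℝ) {s : ι → ℕ → Path → Stake}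
    (hs : ∀ j, Predictable (s j)) : Predictable (mixture c s) := by
  intro n ω ω' hω
  unfold mixture
  simp_rw [fun j => hs j n ω ω' hω]

lemma hasSum_wealth_mixture {ι : Type*} {h : ℝ → ℝ} {c : ι → ℝ} {s : ι → ℕ → Path → Stake}
    {ω : Path} (hM : ∀ n, Summable fun j => c j * (s j n ω).M)
    (hV : ∀ n, Summable fun j => c j * (s j n ω).V)
    (hW : ∀ n, Summable fun j => c j * (s j n ω).W) (n : ℕ) :
    HasSum (fun j => c j * (wealth h (s j) ω n - 1)) (wealth h (mixture c s) ω n - 1) := by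
  induction n with
  | zero => simp
  | succ n ih =>
    have h1 := (hM n).hasSum.mul_right (ω.outcome n - (ω.forecast n).m)
    have h2 := (hV n).hasSum.mul_right
      ((ω.outcome n - (ω.forecast n).m) ^ 2 - (ω.forecast n).v)
    have h3 := (hW n).hasSum.mul_right (h (ω.outcome n - (ω.forecast n).m) - (ω.forecast n).w)
    convert ih.add ((h1.add h2).add h3) using 1
    · funext j
      rw [wealth_succ, gain]
      ring
    · rw [wealth_succ, gain, mixture]
      ring

/-- Weight not assigned to any account is kept in cash, and the accounts outside `F` are
nonnegative. -/
lemma sum_le_wealth_mixture {ι : Type*} {h : ℝ → ℝ} {c : ι → ℝ} {s : ι → ℕ → Path → Stake}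
    {ω : Path} (hM : ∀ n, Summable fun j => c j * (s j n ω).M)
    (hV : ∀ n, Summable fun j => c j * (s j n ω).V)
    (hW : ∀ n, Summable fun j => c j * (s j n ω).W)
    (hc : ∀ j, 0 ≤ c j) (hcs : Summable c) (hc1 : ∑' j, c j ≤ 1)
    (hs : ∀ j n, 0 ≤ wealth h (s j) ω n) (n : ℕ) (F : Finset ι) :
    ∑ j ∈ F, c j * wealth h (s j) ω n ≤ wealth h (mixture c s) ω n := by
  have h1 := (hasSum_wealth_mixture (h := h) hM hV hW n).add hcs.hasSum
  have h2 : HasSum (fun j => c j * wealth h (s j) ω n)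
      (wealth h (mixture c s) ω n - 1 + ∑' j, c j) := by
    convert h1 using 1
    funext j
    ring
  have := sum_le_hasSum F (fun j _ => mul_nonneg (hc j) (hs j n)) h2
  linarith

/-- Since `s j` is idle before round `j`, only finitely many stakes are active in each round and the
geometric mixture needs no convergence argument. One account that tends to infinity suffices. -/
lemma forceable_of_seq {h : ℝ → ℝ} {E : Set Path} (s : ℕ → ℕ → Path → Stake)
    (hs : ∀ j, Predictable (s j)) (h0 : ∀ j, ∀ n < j, ∀ ω, s j n ω = noStake)
    (hn : ∀ j ω n, 0 ≤ wealth h (s j) ω n)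
    (hE : ∀ ω, ω ∉ E → ∀ r, ∃ j ≥ r, Tendsto (wealth h (s j) ω) atTop atTop) :
    Forceable h E := by
  intro r
  set t : ℕ → ℕ → Path → Stake := fun j => s (r + j) with ht
  have ht0 : ∀ j n ω, n < r + j → t j n ω = noStake := fun j n ω hj => h0 _ n hj ω
  set c : ℕ → ℝ := fun j => (1 / 2) ^ j / 2 with hc
  have hcs : HasSum c 1 := by
    simpa only [div_self (two_ne_zero' ℝ)] using hasSum_geometric_two.div_const 2
  have hfin : ∀ n ω (p : Stake → ℝ), p noStake = 0 → Summable fun j => c j * p (t j n ω) := by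
    intro n ω p hp
    refine summable_of_ne_finset_zero (s := Finset.range (n + 1)) fun j hj => ?_
    rw [Finset.mem_range, not_lt] at hj
    rw [ht0 j n ω (by omega), hp, mul_zero]
  have key := fun ω => sum_le_wealth_mixture (h := h) (c := c) (s := t) (ω := ω)
    (fun n => hfin n ω Stake.M rfl) (fun n => hfin n ω Stake.V rfl) (fun n => hfin n ω Stake.W rfl)
    (fun j => by positivity) hcs.summable hcs.tsum_eq.le (fun j n => hn _ ω n)
  refine ⟨mixture c t, predictable_mixture c fun j => hs _, fun n hnr ω => ?_, fun ω n => ?_,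
    fun ω hω => ?_⟩
  · have : ∀ j, t j n ω = noStake := fun j => ht0 j n ω (by omega)
    simp [mixture, this, noStake]
  · simpa using key ω n ∅
  · obtain ⟨j, hj, hjt⟩ := hE ω hω r
    obtain ⟨i, rfl⟩ := Nat.exists_eq_add_of_le hj
    refine tendsto_atTop_mono (fun n => ?_) (hjt.const_mul_atTop (show 0 < c i by positivity))
    simpa using key ω n {i}

lemma Forceable.iInter {ι : Type*} [Countable ι] {h : ℝ → ℝ} {E : ι → Set Path}
    (hE : ∀ i, Forceable h (E i)) : Forceable h (⋂ i, E i) := by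
  rcases isEmpty_or_nonempty ι with hι | hι
  · refine fun r => ⟨fun _ _ => noStake, fun _ _ _ _ => rfl, fun _ _ _ => rfl, fun ω n => ?_,
      fun ω hω => absurd (by simp) hω⟩
    simp [wealth]
  obtain ⟨e, he⟩ := exists_surjective_nat ι
  choose s hs h0 hn ht using fun i r => hE i r
  refine forceable_of_seq (fun j => s (e j.unpair.1) j) (fun j => hs _ _) (fun j => h0 _ _)
    (fun j => hn _ _) fun ω hω r => ?_
  simp only [Set.mem_iInter, not_forall] at hω
  obtain ⟨i, hi⟩ := hω
  obtain ⟨k, rfl⟩ := he i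
  -- Pairing lists each event with arbitrarily late starts.
  refine ⟨Nat.pair k r, Nat.right_le_pair k r, ht _ _ ω ?_⟩
  simpa using hi

lemma Forceable.inter {h : ℝ → ℝ} {E F : Set Path} (hE : Forceable h E) (hF : Forceable h F) :
    Forceable h (E ∩ F) := by
  rw [Set.inter_eq_iInter]
  exact Forceable.iInter fun b => by cases b <;> assumption

/-! ### Stakes that depend on the current capital -/

/-- The capital when the stake is chosen as a function of the current capital. -/
def feedbackWealth (h : ℝ → ℝ) (t : ℕ → Path → ℝ → Stake) (ω : Path) : ℕ → ℝ
  | 0 => 1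
  | n + 1 => feedbackWealth h t ω n
      + gain h (ω.forecast n) (t n ω (feedbackWealth h t ω n)) (ω.outcome n)

lemma feedbackWealth_congr {h : ℝ → ℝ} {t : ℕ → Path → ℝ → Stake} (ht : Predictable t) {n : ℕ}
    {ω ω' : Path} (hω : Path.AgreeAt n ω ω') : feedbackWealth h t ω n = feedbackWealth h t ω' n := by
  induction n with
  | zero => rfl
  | succ n ih =>
    rw [feedbackWealth, feedbackWealth, ih (hω.mono n.le_succ), ht n ω ω' (hω.mono n.le_succ),
      hω.1 n n.le_succ, hω.2 n n.lt_succ_self]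

/-- The recursion `feedbackWealth` resolves the circularity of stakes that refer to the wealth they
generate. -/
lemma exists_feedback (h : ℝ → ℝ) {t : ℕ → Path → ℝ → Stake} (ht : Predictable t)
    (hpos : ∀ n ω K x, 0 ≤ K → 0 ≤ K + gain h (ω.forecast n) (t n ω K) x) :
    ∃ s : ℕ → Path → Stake, Predictable s ∧ (∀ n ω, s n ω = t n ω (wealth h s ω n)) ∧
      ∀ ω n, 0 ≤ wealth h s ω n := by
  set s : ℕ → Path → Stake := fun n ω => t n ω (feedbackWealth h t ω n) with hs
  have hw : ∀ ω n, wealth h s ω n = feedbackWealth h t ω n := by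
    intro ω n
    induction n with
    | zero => simp [feedbackWealth]
    | succ n ih => rw [wealth_succ, feedbackWealth, ih]
  refine ⟨s, fun n ω ω' hω => ?_, fun n ω => by rw [hw], fun ω n => ?_⟩
  · simp only [hs]
    rw [ht n ω ω' hω, feedbackWealth_congr ht hω]
  · rw [hw]
    induction n with
    | zero => simp [feedbackWealth]
    | succ n ih => exact hpos n ω _ _ ih

open Classical in
/-- Skeptic can play any predictable stakes, from round `r` on, as long as they are safe. -/
lemma exists_safe (h : ℝ → ℝ) {s : ℕ → Path → Stake} (hs : Predictable s) (r : ℕ) :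
    ∃ s' : ℕ → Path → Stake, Predictable s' ∧ (∀ n < r, ∀ ω, s' n ω = noStake) ∧
      (∀ ω n, 0 ≤ wealth h s' ω n) ∧
      ∀ ω, (∀ n ≥ r, ∀ x, 0 ≤ 1 + ∑ i ∈ Finset.Ico r n,
          gain h (ω.forecast i) (s i ω) (ω.outcome i) + gain h (ω.forecast n) (s n ω) x) →
        ∀ n ≥ r, wealth h s' ω n
          = 1 + ∑ i ∈ Finset.Ico r n, gain h (ω.forecast i) (s i ω) (ω.outcome i) := by
  set t : ℕ → Path → ℝ → Stake := fun n ω K =>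
    if r ≤ n ∧ ∀ x, 0 ≤ K + gain h (ω.forecast n) (s n ω) x then s n ω else noStake with ht
  obtain ⟨s', p, e, nn⟩ := exists_feedback h (t := t)
    (fun n ω ω' hω => by
      funext K
      simp only [ht]
      rw [hs n ω ω' hω, hω.1 n le_rfl])
    (fun n ω K x hK => by
      simp only [ht]
      split_ifs with hc
      · exact hc.2 x
      · simpa using hK)
  have h0 : ∀ n < r, ∀ ω, s' n ω = noStake := fun n hn ω => by
    rw [e, ht]
    exact if_neg fun hc => absurd hc.1 (not_le.2 hn)
  refine ⟨s', p, h0, nn, fun ω hω n hn => ?_⟩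
  induction n, hn using Nat.le_induction with
  | base => simp [wealth_of_null (fun n hn => h0 n hn ω) le_rfl]
  | succ n hn ih =>
    rw [wealth_succ, Finset.sum_Ico_succ_top hn, ← add_assoc, ← ih, e]
    congr 2
    exact if_pos ⟨hn, fun x => ih ▸ hω n hn x⟩

/-! ### The iterated logarithm -/

/-- The iterated logarithm. -/
def loglog (a : ℝ) : ℝ := Real.log (Real.log a)

lemma one_le_log {a : ℝ} (ha : Real.exp (Real.exp 1) ≤ a) : 1 ≤ Real.log a := by
  have h1 : Real.exp 1 ≤ Real.log a := (Real.le_log_iff_exp_le ((Real.exp_pos _).trans_le ha)).2 ha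
  have := Real.add_one_le_exp (1 : ℝ)
  linarith

lemma one_le_loglog {a : ℝ} (ha : Real.exp (Real.exp 1) ≤ a) : 1 ≤ loglog a := by
  have h1 : Real.exp 1 ≤ Real.log a := (Real.le_log_iff_exp_le ((Real.exp_pos _).trans_le ha)).2 ha
  exact (Real.le_log_iff_exp_le ((Real.exp_pos _).trans_le h1)).2 h1

lemma pos_of_exp_le {a : ℝ} (ha : Real.exp (Real.exp 1) ≤ a) : 0 < a := (Real.exp_pos _).trans_le ha

lemma loglog_mono {a a' : ℝ} (ha : Real.exp (Real.exp 1) ≤ a) (h : a ≤ a') :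
    loglog a ≤ loglog a' := by
  have := one_le_log ha
  have := pos_of_exp_le ha
  unfold loglog
  gcongr

/-- As `log a` and `loglog a` are at least `1`, the increment of `loglog` is at most that of `log`,
which is at most `a' / a - 1`. -/
lemma div_loglog_mono {a a' : ℝ} (ha : Real.exp (Real.exp 1) ≤ a) (h : a ≤ a') :
    a / loglog a ≤ a' / loglog a' := by
  have h1 := one_le_log ha
  have h2 := one_le_loglog ha
  have h3 := one_le_loglog (ha.trans h)
  have a0 := pos_of_exp_le ha
  have a0' := pos_of_exp_le (ha.trans h)
  have l0 : 0 < Real.log a' := by linarith [one_le_log (ha.trans h)]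
  rw [div_le_div_iff₀ (by linarith) (by linarith)]
  have d1 : Real.log a' - Real.log a ≤ a' / a - 1 := by
    rw [← Real.log_div a0'.ne' a0.ne']
    exact Real.log_le_sub_one_of_pos (by positivity)
  have d0 : Real.log a ≤ Real.log a' := by gcongr
  have d2 : loglog a' - loglog a ≤ a' / a - 1 := by
    unfold loglog
    rw [← Real.log_div l0.ne' (by linarith)]
    refine (Real.log_le_sub_one_of_pos (by positivity)).trans (le_trans ?_ d1)
    rw [div_sub_one (by linarith), div_le_iff₀ (by linarith)]
    nlinarith
  have d3 : 0 ≤ a' / a - 1 := by rw [sub_nonneg, one_le_div a0]; exact h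
  have d4 : loglog a' ≤ loglog a * (a' / a) := by nlinarith
  calc a * loglog a' ≤ a * (loglog a * (a' / a)) := by gcongr
    _ = a' * loglog a := by field_simp

lemma tendsto_loglog : Tendsto loglog atTop atTop :=
  Real.tendsto_log_atTop.comp Real.tendsto_log_atTop

/-! ### The quadratic approximation of the exponential martingale -/

/-- The factor by which the capital is multiplied when the stakes are `M = l K`, `V = l ^ 2 K / 2`,
where `K` is the current capital. -/
def factor (l y v : ℝ) : ℝ := 1 + l * y + l ^ 2 / 2 * (y ^ 2 - v)

/-- Second-order Taylor expansion at `t - s ^ 2 / 2`: all terms of order two cancel. It is used with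
`t = l * y` and `s = |l| * √v`. -/
lemma exp_le_quadratic_le_exp {t s : ℝ} (ht : |t| ≤ 1 / 4) (hs0 : 0 ≤ s) (hs : s ≤ 1 / 4) :
    Real.exp (t - s ^ 2 / 2 - 8 * (|t| ^ 3 + s ^ 3)) ≤ 1 + t + t ^ 2 / 2 - s ^ 2 / 2 ∧
      1 + t + t ^ 2 / 2 - s ^ 2 / 2 ≤ Real.exp (t - s ^ 2 / 2 + 8 * (|t| ^ 3 + s ^ 3)) := by
  set a := t - s ^ 2 / 2 with ha
  set δ := |t| ^ 3 + s ^ 3 with hδ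
  have t0 := abs_nonneg t
  have hab : |a| ≤ |t| + s / 8 := by
    rw [ha]
    refine (abs_sub _ _).trans ?_
    rw [abs_of_nonneg (by positivity : 0 ≤ s ^ 2 / 2)]
    nlinarith
  have ha1 : |a| ≤ 1 / 2 := by linarith
  have ha3 : |a| ^ 3 ≤ 4 * δ := by
    have h1 : |a| ^ 3 ≤ (|t| + s / 8) ^ 3 := by gcongr
    have h2 : (|t| + s / 8) ^ 3 ≤ 4 * (|t| ^ 3 + (s / 8) ^ 3) := by
      nlinarith [mul_nonneg (add_nonneg t0 (by positivity : 0 ≤ s / 8)) (sq_nonneg (|t| - s / 8))]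
    have h3 : 0 ≤ s ^ 3 := by positivity
    rw [hδ]
    nlinarith
  have hR := Real.exp_bound (ha1.trans (by norm_num)) (show 0 < 3 by norm_num)
  simp only [Finset.sum_range_succ, Finset.sum_range_zero, Nat.factorial] at hR
  norm_num at hR
  have hR' : |Real.exp a - (1 + a + a ^ 2 / 2)| ≤ 8 / 9 * δ := by linarith
  have hE : |(1 + t + t ^ 2 / 2 - s ^ 2 / 2) - (1 + a + a ^ 2 / 2)| ≤ δ := by
    have e : (1 + t + t ^ 2 / 2 - s ^ 2 / 2) - (1 + a + a ^ 2 / 2)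
        = t * s ^ 2 / 2 - s ^ 4 / 8 := by rw [ha]; ring
    rw [e]
    refine (abs_sub _ _).trans ?_
    rw [abs_of_nonneg (by positivity : 0 ≤ s ^ 4 / 8), abs_div, abs_mul, abs_of_nonneg (sq_nonneg s),
      abs_two]
    have h1 : |t| * s ^ 2 ≤ δ := by
      rw [hδ]
      rcases le_total |t| s with hc | hc
      · have : |t| * s ^ 2 ≤ s * s ^ 2 := by gcongr
        have : 0 ≤ |t| ^ 3 := by positivity
        nlinarith
      · have : |t| * s ^ 2 ≤ |t| * |t| ^ 2 := by gcongr
        have : 0 ≤ s ^ 3 := by positivity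
        nlinarith
    have h2 : s ^ 4 ≤ δ / 4 := by
      have h3 : 0 ≤ |t| ^ 3 := by positivity
      have h4 : 0 ≤ s ^ 3 := by positivity
      rw [hδ]
      nlinarith
    have : 0 ≤ δ := by positivity
    linarith
  have hδ0 : 0 ≤ δ := by positivity
  have hδ1 : δ ≤ 1 / 32 := by
    have h1 : |t| ^ 3 ≤ (1 / 4) ^ 3 := by gcongr
    have h2 : s ^ 3 ≤ (1 / 4) ^ 3 := by gcongr
    rw [hδ]
    linarith
  -- This turns the additive error `2 * δ` into a relative error `4 * δ`, which `exp (± 8 * δ)`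
  -- absorbs as `δ ≤ 1 / 32`.
  have hea : 1 / 2 ≤ Real.exp a := by
    have := Real.add_one_le_exp a
    have := (abs_le.1 ha1).1
    linarith
  have hR1 := abs_le.1 hR'
  have hE1 := abs_le.1 hE
  constructor
  · have h1 : Real.exp (-(8 * δ)) ≤ 1 - 4 * δ := by
      have h2 : Real.exp (-(8 * δ)) * (1 + 8 * δ) ≤ 1 := by
        have := Real.add_one_le_exp (8 * δ)
        calc Real.exp (-(8 * δ)) * (1 + 8 * δ) ≤ Real.exp (-(8 * δ)) * Real.exp (8 * δ) := by
              gcongr; linarith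
          _ = 1 := by rw [← Real.exp_add]; simp
      have h3 : 1 ≤ (1 - 4 * δ) * (1 + 8 * δ) := by nlinarith
      have h4 : 0 < 1 + 8 * δ := by linarith
      exact le_of_mul_le_mul_right (h2.trans h3) h4
    rw [sub_eq_add_neg, Real.exp_add]
    calc Real.exp a * Real.exp (-(8 * δ)) ≤ Real.exp a * (1 - 4 * δ) := by gcongr
      _ ≤ Real.exp a - 2 * δ := by nlinarith
      _ ≤ _ := by linarith
  · have h1 := Real.add_one_le_exp (8 * δ)
    rw [Real.exp_add]
    calc 1 + t + t ^ 2 / 2 - s ^ 2 / 2 ≤ Real.exp a + 2 * δ := by linarith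
      _ ≤ Real.exp a * (1 + 8 * δ) := by nlinarith
      _ ≤ _ := by gcongr; linarith

lemma exp_le_factor_le_exp {l y v B D : ℝ} (hB : 0 < B) (hD : 0 < D) (hl : |l| * B ≤ D)
    (hv : 0 ≤ v) (he : (|y| / B) ^ 3 + (√v / B) ^ 3 ≤ (1 / (4 * D)) ^ 3) :
    Real.exp (l * y - l ^ 2 / 2 * v - 8 * D ^ 3 * ((|y| / B) ^ 3 + (√v / B) ^ 3)) ≤ factor l y v ∧
      factor l y v ≤
        Real.exp (l * y - l ^ 2 / 2 * v + 8 * D ^ 3 * ((|y| / B) ^ 3 + (√v / B) ^ 3)) := by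
  have p1 : 0 ≤ (|y| / B) ^ 3 := by positivity
  have p2 : 0 ≤ (√v / B) ^ 3 := by positivity
  have g : ∀ z, 0 ≤ z → (z / B) ^ 3 ≤ (1 / (4 * D)) ^ 3 →
      |l| * z ≤ 1 / 4 ∧ (|l| * z) ^ 3 ≤ D ^ 3 * (z / B) ^ 3 := by
    intro z hz hz3
    have h1 : z / B ≤ 1 / (4 * D) := le_of_pow_le_pow_left₀ three_ne_zero (by positivity) hz3
    have h2 : |l| * z = (|l| * B) * (z / B) := by field_simp
    have h3 : |l| * z ≤ D * (z / B) := by rw [h2]; gcongr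
    refine ⟨h3.trans ?_, ?_⟩
    · calc D * (z / B) ≤ D * (1 / (4 * D)) := by gcongr
        _ = 1 / 4 := by field_simp
    · rw [← mul_pow]
      gcongr
  obtain ⟨y1, y2⟩ := g |y| (abs_nonneg y) (by linarith)
  obtain ⟨v1, v2⟩ := g (√v) (Real.sqrt_nonneg v) (by linarith)
  rw [← abs_mul] at y1 y2
  have key := exp_le_quadratic_le_exp y1 (by positivity) v1
  have e1 : (|l| * √v) ^ 2 = l ^ 2 * v := by rw [mul_pow, sq_abs, Real.sq_sqrt hv]
  have e2 : 1 + l * y + (l * y) ^ 2 / 2 - (|l| * √v) ^ 2 / 2 = factor l y v := by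
    rw [e1, factor]; ring
  rw [e2, e1] at key
  constructor
  · refine le_trans (Real.exp_le_exp.2 ?_) key.1
    linarith
  · refine key.2.trans (Real.exp_le_exp.2 ?_)
    linarith

/-! ### Quantities along a path -/

namespace Path

variable (ω : Path)

/-- The deviation of the outcome from its price. -/
def dev (n : ℕ) : ℝ := ω.outcome n - (ω.forecast n).m

/-- The sum of the first `n` deviations. -/
def T (n : ℕ) : ℝ := ∑ i ∈ Finset.range n, ω.dev i

/-- The bound on the error made in round `n` by replacing the capital by an exponential. -/
def err (n : ℕ) : ℝ :=
  (|ω.dev n| / ω.b (n + 1)) ^ 3 + (√(ω.forecast n).v / ω.b (n + 1)) ^ 3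

lemma T_eq (n : ℕ) : ω.T n = ω.S n - ∑ i ∈ Finset.range n, (ω.forecast i).m := by
  simp [T, S, dev]

lemma A_succ (n : ℕ) : ω.A (n + 1) = ω.A n + (ω.forecast n).v := Finset.sum_range_succ _ _

lemma T_succ (n : ℕ) : ω.T (n + 1) = ω.T n + ω.dev n := Finset.sum_range_succ _ _

lemma A_mono : Monotone ω.A :=
  monotone_nat_of_le_succ fun n => by
    rw [A_succ]
    exact le_add_of_nonneg_right (ω.forecast n).v_nonneg

lemma A_nonneg (n : ℕ) : 0 ≤ ω.A n := Finset.sum_nonneg fun i _ => (ω.forecast i).v_nonneg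

lemma sum_Ico_v {m n : ℕ} (h : m ≤ n) :
    ∑ i ∈ Finset.Ico m n, (ω.forecast i).v = ω.A n - ω.A m := Finset.sum_Ico_eq_sub _ h

lemma sum_Ico_dev {m n : ℕ} (h : m ≤ n) :
    ∑ i ∈ Finset.Ico m n, ω.dev i = ω.T n - ω.T m := Finset.sum_Ico_eq_sub _ h

lemma b_nonneg (n : ℕ) : 0 ≤ ω.b n := Real.sqrt_nonneg _

lemma err_nonneg (n : ℕ) : 0 ≤ ω.err n := by
  have := ω.b_nonneg (n + 1)
  unfold err
  positivity

variable {ω}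

lemma b_pos {n : ℕ} (h : Real.exp (Real.exp 1) ≤ ω.A n) : 0 < ω.b n := by
  have h1 := one_le_loglog h
  have h2 := pos_of_exp_le h
  unfold loglog at h1
  exact Real.sqrt_pos.2 (by positivity)

lemma b_sq {n : ℕ} (h : Real.exp (Real.exp 1) ≤ ω.A n) : ω.b n ^ 2 = ω.A n / loglog (ω.A n) := by
  have h1 := one_le_loglog h
  have h2 := pos_of_exp_le h
  unfold loglog at h1
  exact Real.sq_sqrt (by positivity)

/-- A multiplier adapted to the level `a` is at most of the order of `1 / b`. -/
lemma mul_b_le {n : ℕ} {l a D : ℝ} (h : Real.exp (Real.exp 1) ≤ ω.A n) (ha : ω.A n ≤ a)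
    (hD : 0 ≤ D) (hl : l ^ 2 * (a / loglog a) ≤ D ^ 2) : |l| * ω.b n ≤ D := by
  refine le_of_sq_le_sq ?_ hD
  rw [mul_pow, sq_abs, b_sq h]
  exact le_trans (by have := div_loglog_mono h ha; gcongr) hl

lemma abs_dev_le {n : ℕ} {ε : ℝ} (h : Real.exp (Real.exp 1) ≤ ω.A (n + 1)) (hε : 0 ≤ ε)
    (he : ω.err n ≤ ε ^ 3) : |ω.dev n| ≤ ε * ω.b (n + 1) := by
  have hb := b_pos h
  have h1 : (|ω.dev n| / ω.b (n + 1)) ^ 3 ≤ ε ^ 3 :=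
    le_trans (le_add_of_nonneg_right (by positivity)) he
  exact (div_le_iff₀ hb).1 (le_of_pow_le_pow_left₀ three_ne_zero hε h1)

lemma sqrt_v_le {n : ℕ} {ε : ℝ} (h : Real.exp (Real.exp 1) ≤ ω.A (n + 1)) (hε : 0 ≤ ε)
    (he : ω.err n ≤ ε ^ 3) : √(ω.forecast n).v ≤ ε * ω.b (n + 1) := by
  have hb := b_pos h
  have h1 : (√(ω.forecast n).v / ω.b (n + 1)) ^ 3 ≤ ε ^ 3 :=
    le_trans (le_add_of_nonneg_left (by positivity)) he
  exact (div_le_iff₀ hb).1 (le_of_pow_le_pow_left₀ three_ne_zero hε h1)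

/-- A small error forces `v ≤ b ^ 2 / 16`, and `b ^ 2 ≤ A`. Hence the variance cannot jump across a
geometric block. -/
lemma A_succ_le_two_mul {n : ℕ} (h : Real.exp (Real.exp 1) ≤ ω.A (n + 1))
    (he : ω.err n ≤ (1 / 4) ^ 3) : ω.A (n + 1) ≤ 2 * ω.A n := by
  have h1 := sqrt_v_le h (by norm_num) he
  have h2 : (ω.forecast n).v ≤ (1 / 4 * ω.b (n + 1)) ^ 2 := (Real.sqrt_le_left (by
    have := ω.b_nonneg (n + 1); positivity)).1 h1
  rw [mul_pow, b_sq h] at h2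
  have h3 : ω.A (n + 1) / loglog (ω.A (n + 1)) ≤ ω.A (n + 1) :=
    div_le_self (ω.A_nonneg _) (one_le_loglog h)
  have := ω.A_succ n
  have := ω.A_nonneg n
  linarith [ω.A_nonneg (n + 1)]

lemma sq_mul_v_le_one {n : ℕ} {l D : ℝ} (h : Real.exp (Real.exp 1) ≤ ω.A (n + 1)) (hD : 0 < D)
    (hl : |l| * ω.b (n + 1) ≤ D) (he : ω.err n ≤ (1 / (4 * D)) ^ 3) :
    l ^ 2 * (ω.forecast n).v ≤ 1 := by
  have h1 := sqrt_v_le h (by positivity) he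
  have h2 : |l| * √(ω.forecast n).v ≤ 1 := by
    calc |l| * √(ω.forecast n).v ≤ |l| * (1 / (4 * D) * ω.b (n + 1)) := by gcongr
      _ = (|l| * ω.b (n + 1)) * (1 / (4 * D)) := by ring
      _ ≤ D * (1 / (4 * D)) := by gcongr
      _ ≤ 1 := by rw [mul_one_div, div_le_one (by positivity)]; linarith
  have h3 : (|l| * √(ω.forecast n).v) ^ 2 ≤ 1 := pow_le_one₀ (by positivity) h2
  rwa [mul_pow, sq_abs, Real.sq_sqrt (ω.forecast n).v_nonneg] at h3

lemma exp_le_prod_factor_le_exp {m n : ℕ} {l D : ℝ} (hD : 0 < D)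
    (hA : ∀ i ∈ Finset.Ico m n, Real.exp (Real.exp 1) ≤ ω.A (i + 1))
    (hl : ∀ i ∈ Finset.Ico m n, |l| * ω.b (i + 1) ≤ D)
    (he : ∀ i ∈ Finset.Ico m n, ω.err i ≤ (1 / (4 * D)) ^ 3) (hmn : m ≤ n) :
    Real.exp (l * (ω.T n - ω.T m) - l ^ 2 / 2 * (ω.A n - ω.A m)
        - 8 * D ^ 3 * ∑ i ∈ Finset.Ico m n, ω.err i)
      ≤ ∏ i ∈ Finset.Ico m n, factor l (ω.dev i) (ω.forecast i).v ∧
    ∏ i ∈ Finset.Ico m n, factor l (ω.dev i) (ω.forecast i).v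
      ≤ Real.exp (l * (ω.T n - ω.T m) - l ^ 2 / 2 * (ω.A n - ω.A m)
        + 8 * D ^ 3 * ∑ i ∈ Finset.Ico m n, ω.err i) := by
  have key := fun i hi => exp_le_factor_le_exp (y := ω.dev i) (b_pos (hA i hi)) hD (hl i hi)
    (ω.forecast i).v_nonneg (he i hi)
  rw [← ω.sum_Ico_dev hmn, ← ω.sum_Ico_v hmn, Finset.mul_sum, Finset.mul_sum, Finset.mul_sum,
    ← Finset.sum_sub_distrib, ← Finset.sum_sub_distrib, ← Finset.sum_add_distrib, Real.exp_sum,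
    Real.exp_sum]
  exact ⟨Finset.prod_le_prod (fun i _ => (Real.exp_pos _).le) fun i hi => (key i hi).1,
    Finset.prod_le_prod (fun i hi => (Real.exp_pos _).le.trans (key i hi).1) fun i hi =>
      (key i hi).2⟩

end Path

/-! ### Predictability of the quantities along a path -/

namespace Path.AgreeAt

variable {n : ℕ} {ω ω' : Path} (hω : Path.AgreeAt n ω ω')

include hω

lemma dev_eq {i : ℕ} (hi : i < n) : ω.dev i = ω'.dev i := by
  rw [Path.dev, Path.dev, hω.1 i hi.le, hω.2 i hi]

/-- The index `n + 1` is allowed because Forecaster announces `v` before Skeptic moves. -/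
lemma A_eq {i : ℕ} (hi : i ≤ n + 1) : ω.A i = ω'.A i := by
  refine Finset.sum_congr rfl fun j hj => ?_
  rw [hω.1 j (by have := Finset.mem_range.1 hj; omega)]

lemma b_eq {i : ℕ} (hi : i ≤ n + 1) : ω.b i = ω'.b i := by
  rw [Path.b, Path.b, hω.A_eq hi]

end Path.AgreeAt

/-! ### Summability of the hedge payoffs and of the approximation errors -/

/-- The ratio of the price of the extra hedge in round `n` to `h (b (n + 1))`. -/
def Path.hedgePrice (h : ℝ → ℝ) (ω : Path) (n : ℕ) : ℝ := (ω.forecast n).w / h (ω.b (n + 1))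

/-- The ratio of the payoff of the extra hedge in round `n` to `h (b (n + 1))`. -/
def Path.hedgePayoff (h : ℝ → ℝ) (ω : Path) (n : ℕ) : ℝ := h (ω.dev n) / h (ω.b (n + 1))

lemma tendsto_sum_Ico_of_not_summable {f : ℕ → ℝ} (hf : ∀ n, 0 ≤ f n) (hs : ¬ Summable f) (r : ℕ) :
    Tendsto (fun n => ∑ i ∈ Finset.Ico r n, f i) atTop atTop := by
  have h1 := (not_summable_iff_tendsto_nat_atTop_of_nonneg hf).1 hs
  have h2 := tendsto_atTop_add_const_right _ (-∑ i ∈ Finset.range r, f i) h1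
  refine h2.congr' ?_
  filter_upwards [eventually_ge_atTop r] with n hn
  rw [Finset.sum_Ico_eq_sub _ hn, sub_eq_add_neg]

/-- Late blocks of a summable nonnegative series have small sums. -/
lemma exists_forall_sum_Ico_le {f : ℕ → ℝ} (hf : ∀ n, 0 ≤ f n) (hs : Summable f) {ε : ℝ}
    (hε : 0 < ε) : ∃ N, ∀ r ≥ N, ∀ n, ∑ i ∈ Finset.Ico r n, f i ≤ ε := by
  have h1 := (tendsto_sum_nat_add f).eventually_lt_const hε
  obtain ⟨N, hN⟩ := h1.exists
  refine ⟨N, fun r hr n => ?_⟩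
  have h3 : ∑ i ∈ Finset.Ico r n, f i ≤ ∑ i ∈ Finset.Ico N (max N n), f i :=
    Finset.sum_le_sum_of_subset_of_nonneg
      (Finset.Ico_subset_Ico hr (le_max_right _ _)) fun i _ _ => hf i
  rw [Finset.sum_Ico_eq_sum_range f N] at h3
  have h4 := ((summable_nat_add_iff N).2 hs).sum_le_tsum (Finset.range (max N n - N))
    fun i _ => hf _
  simp only [add_comm _ N] at h4 hN
  linarith

variable {h : ℝ → ℝ}

lemma hedgePrice_nonneg (hh : IsExtraHedge h) (ω : Path) (n : ℕ) : 0 ≤ ω.hedgePrice h n :=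
  div_nonneg (ω.forecast n).w_nonneg (hh.nonneg _)

lemma hedgePayoff_nonneg (hh : IsExtraHedge h) (ω : Path) (n : ℕ) : 0 ≤ ω.hedgePayoff h n :=
  div_nonneg (hh.nonneg _) (hh.nonneg _)

/-- If the scaled prices of the extra hedge are summable, so are its scaled payoffs. -/
lemma forceable_summable_hedgePayoff (hh : IsExtraHedge h) :
    Forceable h {ω | Summable (ω.hedgePrice h) → Summable (ω.hedgePayoff h)} := by
  -- Buying the scaled hedge in every round costs at most `1` in total when the start is late
  -- enough.
  set s : ℕ → Path → Stake := fun n ω => ⟨0, 0, 1 / h (ω.b (n + 1))⟩ with hs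
  have hp : Predictable s := fun n ω ω' hω => by simp only [hs]; rw [hω.b_eq le_rfl]
  have hg : ∀ n ω x, gain h (ω.forecast n) (s n ω) x
      = h (x - (ω.forecast n).m) / h (ω.b (n + 1)) - ω.hedgePrice h n := fun n ω x => by
    simp only [gain, hs, Path.hedgePrice]
    ring
  choose s' p' h0 hn hw using exists_safe h hp
  refine forceable_of_seq s' p' h0 hn fun ω hω r => ?_
  simp only [Set.mem_ofPred_eq, Classical.not_imp] at hω
  obtain ⟨hz, hu⟩ := hω
  obtain ⟨N, hN⟩ := exists_forall_sum_Ico_le (hedgePrice_nonneg hh ω) hz zero_lt_one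
  refine ⟨max r N, le_max_left _ _, ?_⟩
  set q := max r N
  have hsum : ∀ n, ∑ i ∈ Finset.Ico q n, gain h (ω.forecast i) (s i ω) (ω.outcome i)
      = ∑ i ∈ Finset.Ico q n, ω.hedgePayoff h i - ∑ i ∈ Finset.Ico q n, ω.hedgePrice h i :=
    fun n => by
      rw [← Finset.sum_sub_distrib]
      exact Finset.sum_congr rfl fun i _ => hg i ω _
  have hle := hN q (le_max_right _ _)
  have hw' := hw q ω fun n hnq x => by
    have h1 := hle (n + 1)
    rw [Finset.sum_Ico_succ_top hnq] at h1
    have h2 : 0 ≤ ∑ i ∈ Finset.Ico q n, ω.hedgePayoff h i :=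
      Finset.sum_nonneg fun i _ => hedgePayoff_nonneg hh ω i
    have h3 : 0 ≤ h (x - (ω.forecast n).m) / h (ω.b (n + 1)) :=
      div_nonneg (hh.nonneg _) (hh.nonneg _)
    rw [hsum, hg]
    linarith
  refine tendsto_atTop_mono' _ ?_ (tendsto_sum_Ico_of_not_summable (hedgePayoff_nonneg hh ω) hu q)
  filter_upwards [eventually_ge_atTop q] with n hnq
  rw [hw' n hnq, hsum]
  linarith [hle n]

/-- On a coherent path with summable scaled prices and payoffs of the extra hedge, the
approximation errors are summable. -/
lemma summable_err (hh : IsExtraHedge h) {ω : Path} (hA : Tendsto ω.A atTop atTop)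
    (hc : ∀ n, (ω.forecast n).IsCoherent h) (hz : Summable (ω.hedgePrice h))
    (hu : Summable (ω.hedgePayoff h)) : Summable ω.err := by
  have hu0 := hu.tendsto_atTop_zero.eventually_lt_const (show (0 : ℝ) < 1 ^ 3 by norm_num)
  have hz0 := hz.tendsto_atTop_zero.eventually_lt_const (show (0 : ℝ) < 1 ^ 3 by norm_num)
  have hA' := ((tendsto_add_atTop_iff_nat 1).2 hA).eventually_ge_atTop (Real.exp (Real.exp 1))
  refine Summable.of_norm_bounded_eventually_nat (g := fun n => ω.hedgePayoff h n + 3 * ω.hedgePrice h n)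
    (hu.add (hz.mul_left 3)) ?_
  filter_upwards [hu0, hz0, hA'] with n h1 h2 h3
  have hb := Path.b_pos h3
  rw [Real.norm_of_nonneg (ω.err_nonneg n), Path.err]
  have a1 := hh.abs_lt_of_ratio_lt hb one_pos le_rfl h1
  rw [one_mul] at a1
  have a2 := hh.cube_le hb a1.le
  set q := √((ω.forecast n).v / 2) with hq
  have q0 : 0 ≤ q := Real.sqrt_nonneg _
  have b1 : h q / h (ω.b (n + 1)) ≤ ω.hedgePrice h n := by
    have := hh.apply_sqrt_le_of_isCoherent (hc n)
    have := hh.nonneg (ω.b (n + 1))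
    unfold Path.hedgePrice
    gcongr
  have b2 := hh.abs_lt_of_ratio_lt hb one_pos le_rfl (b1.trans_lt h2)
  rw [one_mul] at b2
  have b3 := hh.cube_le hb b2.le
  rw [abs_of_nonneg q0] at b3
  have b4 : (√(ω.forecast n).v / ω.b (n + 1)) ^ 3 ≤ 3 * (q / ω.b (n + 1)) ^ 3 := by
    have e : √(ω.forecast n).v = √2 * q := by
      rw [hq, ← Real.sqrt_mul (by norm_num)]
      congr 1
      ring
    have e3 : √2 ^ 3 ≤ 3 := by
      have s1 := Real.sq_sqrt (show (0 : ℝ) ≤ 2 by norm_num)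
      have s2 : √2 ≤ 1.5 := Real.sqrt_le_iff.2 (by norm_num)
      nlinarith
    rw [e, mul_div_assoc, mul_pow]
    gcongr
  unfold Path.hedgePayoff
  linarith

/-! ### The upper bound -/

/-- The multiplier that is optimal for the deviations at the level `a` of the variance. -/
def optMul (a : ℝ) : ℝ := √(2 * loglog a / a)

lemma optMul_nonneg (a : ℝ) : 0 ≤ optMul a := Real.sqrt_nonneg _

lemma optMul_sq {a : ℝ} (ha : Real.exp (Real.exp 1) ≤ a) : optMul a ^ 2 = 2 * loglog a / a := by
  have := one_le_loglog ha
  have := pos_of_exp_le ha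
  exact Real.sq_sqrt (by positivity)

lemma optMul_mul_sqrt {a : ℝ} (ha : Real.exp (Real.exp 1) ≤ a) :
    optMul a * √(2 * a * loglog a) = 2 * loglog a := by
  have := one_le_loglog ha
  have := pos_of_exp_le ha
  rw [optMul, ← Real.sqrt_mul (by positivity), Real.sqrt_eq_iff_mul_self_eq (by positivity)
    (by positivity)]
  field_simp

lemma loglog_pow (q : ℝ) (k : ℕ) : loglog (q ^ k) = Real.log (k * Real.log q) := by
  rw [loglog, Real.log_pow]

/-- These sums dominate the weighted stakes `M` and `V` of the accounts, so that their infinite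
mixture is defined. -/
lemma summable_optMul_sq {q : ℝ} (hq : 1 < q) (hq2 : q ≤ 2) :
    Summable (fun k : ℕ => optMul (q ^ k)) ∧ Summable (fun k : ℕ => optMul (q ^ k) ^ 2) := by
  have hb : ∀ k : ℕ, optMul (q ^ k) ^ 2 ≤ 2 * k / q ^ k := fun k => by
    have h1 : 2 * loglog (q ^ k) / q ^ k ≤ 2 * k / q ^ k := by
      have hl : 0 ≤ Real.log q := Real.log_nonneg hq.le
      have hl1 : Real.log q ≤ 1 := (Real.log_le_sub_one_of_pos (by linarith)).trans (by linarith)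
      rw [loglog_pow]
      have h2 : Real.log (k * Real.log q) ≤ k * Real.log q := Real.log_le_self (by positivity)
      have h3 : (k : ℝ) * Real.log q ≤ k := mul_le_of_le_one_right (by positivity) hl1
      gcongr
      linarith
    rw [optMul, Real.sq_sqrt']
    exact max_le h1 (by positivity)
  have hg : ∀ p : ℝ, 0 ≤ p → p < 1 → Summable fun k : ℕ => (k : ℝ) * p ^ k := fun p h0 h1 => by
    simpa using summable_pow_mul_geometric_of_norm_lt_one (R := ℝ) 1
      (by rwa [Real.norm_of_nonneg h0])
  constructor
  · refine Summable.of_nonneg_of_le (fun k => optMul_nonneg _) (fun k => ?_)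
      ((hg (1 / √q) (by positivity) ?_).mul_left 2)
    · refine le_of_sq_le_sq ((hb k).trans ?_) (by positivity)
      rw [one_div, inv_pow, mul_pow, mul_pow, inv_pow, ← pow_mul, mul_comm k 2, pow_mul,
        Real.sq_sqrt (by linarith), div_eq_mul_inv, ← mul_assoc]
      have : (k : ℝ) ≤ k ^ 2 := by exact_mod_cast Nat.le_self_pow two_ne_zero k
      gcongr
      linarith
    · rw [div_lt_one (Real.sqrt_pos.2 (by linarith))]
      exact Real.lt_sqrt_of_sq_lt (by linarith)
  · refine Summable.of_nonneg_of_le (fun k => sq_nonneg _) (fun k => (hb k).trans_eq ?_)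
      ((hg (1 / q) (by positivity) ((div_lt_one (by linarith)).2 hq)).mul_left 2)
    rw [one_div, inv_pow]
    ring

/-- Completing the square: twice the factor is `(1 + l * y) ^ 2 + 1 - l ^ 2 * v`. -/
lemma factor_nonneg {l y v : ℝ} (h : l ^ 2 * v ≤ 1) : 0 ≤ factor l y v := by
  unfold factor
  nlinarith [sq_nonneg (1 + l * y)]

lemma add_gain_eq_mul_factor (h : ℝ → ℝ) (f : Forecast) (K l x : ℝ) :
    K + gain h f ⟨l * K, l ^ 2 / 2 * K, 0⟩ x = K * factor l (x - f.m) f.v := by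
  simp only [gain, factor]
  ring

/-- An account that multiplies its capital by the factors with multiplier `l`, from round `r` on,
until it has reached `1 / c`. -/
lemma exists_account (h : ℝ → ℝ) (r : ℕ) (l : ℝ) {c : ℝ} (hc : 0 < c) :
    ∃ s : ℕ → Path → Stake, Predictable s ∧ (∀ n < r, ∀ ω, s n ω = noStake) ∧
      (∀ ω n, 0 ≤ wealth h s ω n) ∧
      (∀ n ω, |c * (s n ω).M| ≤ |l| ∧ |c * (s n ω).V| ≤ l ^ 2 ∧ (s n ω).W = 0) ∧
      ∀ ω n, r ≤ n → (∀ i ∈ Finset.Ico r n, l ^ 2 * (ω.forecast i).v ≤ 1) →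
        1 ≤ c * ∏ i ∈ Finset.Ico r n, factor l (ω.dev i) (ω.forecast i).v →
        ∀ m ≥ n, 1 ≤ c * wealth h s ω m := by
  classical
  -- Stopping at `1 / c` secures the gain forever and bounds the weighted stakes by `|l|` and `l ^
  -- 2`.
  set t : ℕ → Path → ℝ → Stake := fun n ω K =>
    if r ≤ n ∧ l ^ 2 * (ω.forecast n).v ≤ 1 ∧ c * K < 1 then ⟨l * K, l ^ 2 / 2 * K, 0⟩
    else noStake with ht
  obtain ⟨s, hp, e, nn⟩ := exists_feedback h (t := t)
    (fun n ω ω' hω => by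
      funext K
      simp only [ht]
      rw [hω.1 n le_rfl])
    (fun n ω K x hK => by
      simp only [ht]
      split_ifs with hcond
      · rw [add_gain_eq_mul_factor]
        exact mul_nonneg hK (factor_nonneg hcond.2.1)
      · simpa using hK)
  have h0 : ∀ n < r, ∀ ω, s n ω = noStake := fun n hn ω => by
    rw [e, ht]
    exact if_neg fun hcond => absurd hcond.1 (not_le.2 hn)
  refine ⟨s, hp, h0, nn, fun n ω => ?_, fun ω n hrn hv hprod => ?_⟩
  · rw [e, ht]
    simp only
    split_ifs with hcond
    · have k0 := mul_nonneg hc.le (nn ω n)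
      have k1 := hcond.2.2.le
      refine ⟨?_, ?_, rfl⟩
      · rw [show c * (l * wealth h s ω n) = l * (c * wealth h s ω n) by ring, abs_mul,
          abs_of_nonneg k0]
        exact mul_le_of_le_one_right (abs_nonneg _) k1
      · rw [show c * (l ^ 2 / 2 * wealth h s ω n) = l ^ 2 * (c * wealth h s ω n / 2) by ring,
          abs_of_nonneg (by positivity)]
        exact mul_le_of_le_one_right (sq_nonneg _) (by linarith)
    · simp [noStake, sq_nonneg]
  · have frozen : ∀ i, 1 ≤ c * wealth h s ω i → ∀ m ≥ i, 1 ≤ c * wealth h s ω m := by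
      intro i hi m hm
      induction m, hm using Nat.le_induction with
      | base => exact hi
      | succ m _ ih =>
        rw [wealth_succ, e, ht]
        simp only
        rw [if_neg fun hcond => absurd hcond.2.2 (not_lt.2 ih)]
        simpa using ih
    by_cases hex : ∃ i ≤ n, 1 ≤ c * wealth h s ω i
    · obtain ⟨i, hin, hi⟩ := hex
      exact fun m hm => frozen i hi m (hin.trans hm)
    · push Not at hex
      have hw : ∀ j ≥ r, j ≤ n →
          wealth h s ω j = ∏ i ∈ Finset.Ico r j, factor l (ω.dev i) (ω.forecast i).v := by
        intro j hj
        induction j, hj using Nat.le_induction with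
        | base => intro _; simp [wealth_of_null (fun n hn => h0 n hn ω) le_rfl]
        | succ j hj ih =>
          intro hjn
          rw [Finset.prod_Ico_succ_top hj, ← ih (by omega), wealth_succ, e, ht]
          simp only
          rw [if_pos ⟨hj, hv j (Finset.mem_Ico.2 ⟨hj, hjn⟩), hex j (by omega)⟩,
            add_gain_eq_mul_factor]
          rfl
      rw [← hw n hrn le_rfl] at hprod
      exact absurd (hex n le_rfl) (not_lt.2 hprod)

/-- Normalized weights that decay polynomially. -/
lemma exists_weights {p : ℝ} (hp : 1 < p) :
    ∃ c : ℕ → ℝ, (∀ k, 0 < c k) ∧ Summable c ∧ ∑' k, c k ≤ 1 ∧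
      ∃ C : ℝ, ∀ k : ℕ, 1 ≤ k → ∀ E : ℝ, C + p * Real.log k ≤ E → 1 ≤ c k * Real.exp E := by
  have hs : Summable fun k : ℕ => 1 / ((k : ℝ) + 1) ^ p := by
    have := (summable_nat_add_iff 1).2 (Real.summable_one_div_nat_rpow.2 hp)
    simpa using this
  set Z := 1 + ∑' k : ℕ, 1 / ((k : ℝ) + 1) ^ p with hZ
  have hpos : ∀ k : ℕ, 0 < 1 / ((k : ℝ) + 1) ^ p := fun k => by positivity
  have ht0 : 0 ≤ ∑' k : ℕ, 1 / ((k : ℝ) + 1) ^ p := tsum_nonneg fun k => (hpos k).le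
  have hZ0 : 0 < Z := by linarith
  refine ⟨fun k => 1 / ((k : ℝ) + 1) ^ p / Z, fun k => div_pos (hpos k) hZ0, hs.div_const Z, ?_,
    Real.log Z + p * Real.log 2, fun k hk E hE => ?_⟩
  · rw [tsum_div_const, div_le_one hZ0]
    linarith
  · have hk' : (1 : ℝ) ≤ k := by exact_mod_cast hk
    have h1 : Z * ((k : ℝ) + 1) ^ p ≤ Real.exp E := by
      calc Z * ((k : ℝ) + 1) ^ p ≤ Z * (2 * k) ^ p := by
            gcongr
            linarith
        _ = Real.exp (Real.log Z + p * Real.log 2 + p * Real.log k) := by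
          rw [add_assoc, ← mul_add, ← Real.log_mul (by norm_num) (by positivity), Real.exp_add,
            Real.exp_log hZ0, mul_comm p, Real.exp_mul, Real.exp_log (by positivity)]
        _ ≤ Real.exp E := Real.exp_le_exp.2 hE
    beta_reduce
    rw [div_div, one_div_mul_eq_div, one_le_div (by positivity)]
    linarith

/-- Take `k` with `q ^ k ≤ A n < q ^ (k + 1)`, `q = 1 + η`, and `L = loglog (q ^ k)`. The linear
term of the exponent is at least `2 * (1 + η) * L` and the quadratic one at most `(1 + η) * L`. What
remains exceeds the cost `(1 + η / 2) * log k` of the weight. -/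
lemma exists_account_good {η σ : ℝ} (hη : 0 < η) (hη1 : η ≤ 1) (hσ : |σ| = 1) {ω : Path}
    (hA : Tendsto ω.A atTop atTop) {r : ℕ} (hr : ∀ i ≥ r, Real.exp (Real.exp 1) ≤ ω.A (i + 1))
    (he : ∀ i ≥ r, ω.err i ≤ (1 / (4 * 2)) ^ 3) (hes : ∀ n, ∑ i ∈ Finset.Ico r n, ω.err i ≤ 1)
    (hfr : ∃ᶠ n in atTop, (1 + η) * √(2 * ω.A n * loglog (ω.A n)) < σ * ω.T n) (C : ℝ) (k₀ : ℕ) :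
    ∃ k ≥ k₀, 1 ≤ k ∧ ∃ n ≥ r,
      (∀ i ∈ Finset.Ico r n, (σ * optMul ((1 + η) ^ k)) ^ 2 * (ω.forecast i).v ≤ 1) ∧
      ∃ E, C + (1 + η / 2) * Real.log k ≤ E ∧ Real.exp E ≤ ∏ i ∈ Finset.Ico r n,
        factor (σ * optMul ((1 + η) ^ k)) (ω.dev i) (ω.forecast i).v := by
  set q := 1 + η with hq
  have hq1 : 1 < q := by linarith
  have hlq : 0 < Real.log q := Real.log_pos hq1
  have e1 : ∀ᶠ k : ℕ in atTop, Real.exp (Real.exp 1) ≤ q ^ k :=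
    (tendsto_pow_atTop_atTop_of_one_lt hq1).eventually_ge_atTop _
  have e2 : ∀ᶠ k : ℕ in atTop, optMul (q ^ k) * |ω.T r| < 1 := by
    have := (summable_optMul_sq hq1 (by linarith)).1.tendsto_atTop_zero.mul_const |ω.T r|
    rw [zero_mul] at this
    exact this.eventually_lt_const one_pos
  -- Here `65 = 8 * 2 ^ 3 + 1`: the approximation error with `D = 2`, and the bound `1` on the
  -- contribution of `T r`.
  have e3 : ∀ᶠ k : ℕ in atTop,
      C + (1 + η / 2) * Real.log k ≤ (1 + η) * loglog (q ^ k) - 65 := by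
    have h1 : Tendsto (fun k : ℕ => η / 2 * Real.log k) atTop atTop :=
      (Real.tendsto_log_atTop.comp tendsto_natCast_atTop_atTop).const_mul_atTop (by positivity)
    filter_upwards [h1.eventually_ge_atTop (C + 65 - (1 + η) * Real.log (Real.log q)),
      eventually_ge_atTop 1] with k hk hk1
    have hk1' : (0 : ℝ) < k := by exact_mod_cast hk1
    rw [loglog_pow, Real.log_mul hk1'.ne' hlq.ne']
    linarith
  obtain ⟨K, hK⟩ := (e1.and (e2.and (e3.and ((eventually_ge_atTop k₀).and
    (eventually_ge_atTop 1))))).exists_forall_of_atTop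
  obtain ⟨n, hn, hnA, hnr⟩ := (hfr.and_eventually ((hA.eventually_ge_atTop (q ^ K)).and
    (eventually_ge_atTop r))).exists
  obtain ⟨k, hk1, hk2⟩ := exists_nat_pow_near (one_le_pow₀ hq1.le |>.trans hnA) hq1
  have hKk : K ≤ k := by
    have := (pow_lt_pow_iff_right₀ hq1).1 (hnA.trans_lt hk2)
    omega
  obtain ⟨f1, f2, f3, f4, f5⟩ := hK k hKk
  set l := optMul (q ^ k) with hl
  have l0 : 0 ≤ l := optMul_nonneg _
  have hlσ : |σ * l| = l := by rw [abs_mul, hσ, one_mul, abs_of_nonneg l0]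
  have hlσ2 : (σ * l) ^ 2 = l ^ 2 := by rw [← sq_abs, hlσ]
  have hl2 : l ^ 2 = 2 * loglog (q ^ k) / q ^ k := optMul_sq f1
  have hL := one_le_loglog f1
  have hqk : q ^ k ≤ q ^ (k + 1) := pow_le_pow_right₀ hq1.le k.le_succ
  have hL' := loglog_mono f1 hqk
  have hb : ∀ i ∈ Finset.Ico r n, |σ * l| * ω.b (i + 1) ≤ 2 := by
    intro i hi
    obtain ⟨hi1, hi2⟩ := Finset.mem_Ico.1 hi
    refine Path.mul_b_le (hr i hi1) ((ω.A_mono hi2).trans hk2.le) (by norm_num) ?_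
    rw [hlσ2, hl2, pow_succ q k]
    rw [pow_succ q k] at hL'
    have : 0 < q ^ k := by positivity
    calc 2 * loglog (q ^ k) / q ^ k * (q ^ k * q / loglog (q ^ k * q))
        = 2 * q * (loglog (q ^ k) / loglog (q ^ k * q)) := by field_simp
      _ ≤ 2 * q * 1 := by
        gcongr
        exact (div_le_one (by linarith)).2 hL'
      _ ≤ 2 ^ 2 := by linarith
  refine ⟨k, f4, f5, n, hnr, fun i hi => ?_, _, f3, ?_⟩
  · have hi1 := (Finset.mem_Ico.1 hi).1
    exact Path.sq_mul_v_le_one (hr i hi1) two_pos (hb i hi) (he i hi1)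
  · refine le_trans (Real.exp_le_exp.2 ?_) (Path.exp_le_prod_factor_le_exp two_pos
      (fun i hi => hr i (Finset.mem_Ico.1 hi).1) hb (fun i hi => he i (Finset.mem_Ico.1 hi).1)
      hnr).1
    have g1 : (1 + η) * (2 * loglog (q ^ k)) ≤ l * (σ * ω.T n) := by
      refine le_trans ?_ (mul_le_mul_of_nonneg_left hn.le l0)
      rw [← optMul_mul_sqrt f1, mul_left_comm]
      have : loglog (q ^ k) ≤ loglog (ω.A n) := loglog_mono f1 hk1
      have := ω.A_nonneg n
      gcongr
    have g2 : l ^ 2 / 2 * ω.A n ≤ q * loglog (q ^ k) := by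
      calc l ^ 2 / 2 * ω.A n ≤ l ^ 2 / 2 * q ^ (k + 1) := by gcongr
        _ = q * loglog (q ^ k) := by
          have : 0 < q ^ k := by positivity
          rw [hl2, pow_succ]
          field_simp
    have g3 : σ * l * ω.T r ≤ 1 := by
      refine (le_abs_self _).trans ?_
      rw [abs_mul, hlσ]
      exact f2.le
    have g4 : 0 ≤ l ^ 2 / 2 * ω.A r := mul_nonneg (by positivity) (ω.A_nonneg r)
    have g5 := hes n
    rw [hlσ2]
    nlinarith

/-- The upper bound in the law of the iterated logarithm, for both signs `σ`. -/
lemma forceable_upper (h : ℝ → ℝ) {η σ : ℝ} (hη : 0 < η) (hη1 : η ≤ 1) (hσ : |σ| = 1) :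
    Forceable h {ω | Tendsto ω.A atTop atTop → Summable ω.err →
      ∀ᶠ n in atTop, σ * ω.T n ≤ (1 + η) * √(2 * ω.A n * loglog (ω.A n))} := by
  obtain ⟨c, c0, cs, c1, C, hC⟩ := exists_weights (show 1 < 1 + η / 2 by linarith)
  set l : ℕ → ℝ := fun k => σ * optMul ((1 + η) ^ k) with hl
  obtain ⟨hs1, hs2⟩ := summable_optMul_sq (show 1 < 1 + η by linarith) (by linarith)
  have hl1 : ∀ k, |l k| = optMul ((1 + η) ^ k) := fun k => by
    rw [hl, abs_mul, hσ, one_mul, abs_of_nonneg (optMul_nonneg _)]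
  choose s hp h0 hn hb hgood using fun r k => exists_account h r (l k) (c0 k)
  have key := fun r ω => sum_le_wealth_mixture (h := h) (c := c) (s := s r) (ω := ω)
    (fun n => Summable.of_norm_bounded hs1 fun k => by rw [← hl1]; exact (hb r k n ω).1)
    (fun n => Summable.of_norm_bounded hs2 fun k => by
      rw [← hl1, sq_abs]; exact (hb r k n ω).2.1)
    (fun n => by simp [(hb r _ n ω).2.2]) (fun k => (c0 k).le) cs c1 (fun k n => hn r k ω n)
  refine forceable_of_seq (fun r => mixture c (s r)) (fun r => predictable_mixture c (hp r))
    (fun r n hnr ω => ?_) (fun r ω n => by simpa using key r ω n ∅) fun ω hω r₀ => ?_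
  · simp [mixture, h0 r _ n hnr ω, noStake]
  simp only [Set.mem_ofPred_eq, Classical.not_imp, not_eventually, not_le] at hω
  obtain ⟨hA, he, hfr⟩ := hω
  have e1 := ((tendsto_add_atTop_iff_nat 1).2 hA).eventually_ge_atTop (Real.exp (Real.exp 1))
  have e2 := he.tendsto_atTop_zero.eventually_le_const
    (show (0 : ℝ) < (1 / (4 * 2)) ^ 3 by norm_num)
  obtain ⟨N₁, hN₁⟩ := (e1.and e2).exists_forall_of_atTop
  obtain ⟨N₂, hN₂⟩ := exists_forall_sum_Ico_le ω.err_nonneg he one_pos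
  set r := max r₀ (max N₁ N₂) with hr
  refine ⟨r, le_max_left _ _, ?_⟩
  have hr1 : N₁ ≤ r := by omega
  have hr2 : N₂ ≤ r := by omega
  set G : Set ℕ := {k | ∀ᶠ m in atTop, 1 ≤ c k * wealth h (s r k) ω m} with hG
  have hinf : G.Infinite := by
    refine Set.infinite_of_not_bddAbove fun ⟨B, hB⟩ => ?_
    obtain ⟨k, hk, hk1, n, hnr, hv, E, hE, hprod⟩ := exists_account_good hη hη1 hσ hA
      (fun i hi => (hN₁ i (hr1.trans hi)).1) (fun i hi => (hN₁ i (hr1.trans hi)).2)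
      (hN₂ r hr2) hfr C (B + 1)
    have hkG : k ∈ G := by
      filter_upwards [eventually_ge_atTop n] with m hm
      refine hgood r k ω n hnr hv ((hC k hk1 E hE).trans ?_) m hm
      have := (c0 k).le
      gcongr
    have := hB hkG
    omega
  refine tendsto_atTop.2 fun B => ?_
  obtain ⟨M, hM⟩ := exists_nat_ge B
  obtain ⟨F, hF, hFc⟩ := hinf.exists_subset_card_eq M
  have hev : ∀ᶠ m in atTop, ∀ k ∈ F, 1 ≤ c k * wealth h (s r k) ω m :=
    (eventually_all_finset F).2 fun k hk => hF hk
  filter_upwards [hev] with m hm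
  refine hM.trans (le_trans ?_ (key r ω m F))
  rw [← hFc]
  simpa using Finset.card_nsmul_le_sum F _ 1 hm

/-! ### The lower bound -/

/-- If the multiplier `l` has exponent `X - Y`, then `(1 - η) * l` has `(1 - η) * X - (1 - η) ^ 2 *
Y`, and the quantity bounded is the difference. Its main term is `-η ^ 2 * L`; `β` measures the
variance accumulated before the block. -/
lemma block_end_exponent_le {η β L X Y : ℝ} (hη : 0 ≤ η) (hη1 : η ≤ 1) (hβ0 : 0 ≤ β)
    (hβ : β ≤ η / 20) (hL : 0 ≤ L) (hL8 : 8 ≤ η ^ 2 * L) (hX : X ≤ L * (2 * (1 - η) + 4 * β) + 1 / 4)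
    (hY : L * (1 - β ^ 2) ≤ Y) : η * X - (2 * η - η ^ 2) * Y ≤ -3 := by
  have h1 := mul_le_mul_of_nonneg_left hX hη
  have h2 := mul_le_mul_of_nonneg_left hY (by nlinarith : 0 ≤ 2 * η - η ^ 2)
  have hβ2 : β ^ 2 ≤ η / 400 := by nlinarith
  have h3 : 2 * (1 - η) + 4 * β - (2 - η) * (1 - β ^ 2) ≤ -(7 / 10) * η := by
    have : 0 ≤ η * β ^ 2 := by positivity
    linarith
  have h4 := mul_le_mul_of_nonneg_left h3 (mul_nonneg hη hL)
  linarith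

namespace Path

variable (q : ℕ) (ω : Path)

/-- The index of the geometric block `[q ^ k, q ^ (k + 1))` that contains `A n`. -/
def block (n : ℕ) : ℕ := Nat.log q ⌊ω.A n⌋₊

variable {q ω}

lemma block_mono : Monotone (ω.block q) := fun _ _ hmn =>
  Nat.log_mono_right (Nat.floor_mono (ω.A_mono hmn))

lemma lt_pow_block (hq : 1 < q) (n : ℕ) : ω.A n < (q : ℝ) ^ (ω.block q n + 1) := by
  have := Nat.lt_pow_succ_log_self hq ⌊ω.A n⌋₊
  exact_mod_cast (Nat.floor_lt (ω.A_nonneg n)).1 this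

lemma le_block_iff (hq : 1 < q) {n k : ℕ} (hA : 1 ≤ ω.A n) :
    k ≤ ω.block q n ↔ (q : ℝ) ^ k ≤ ω.A n := by
  have h1 : ⌊ω.A n⌋₊ ≠ 0 := (Nat.floor_pos.2 hA).ne'
  rw [block, Nat.le_log_iff_pow_le hq h1, Nat.le_floor_iff (ω.A_nonneg n)]
  push_cast
  rfl

lemma tendsto_block (hq : 1 < q) (hA : Tendsto ω.A atTop atTop) :
    Tendsto (ω.block q) atTop atTop := by
  refine tendsto_atTop.2 fun k => ?_
  filter_upwards [hA.eventually_ge_atTop ((q : ℝ) ^ k), hA.eventually_ge_atTop 1] with n h1 h2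
  exact (le_block_iff hq h2).2 h1

variable (q ω)

/-- The product of the factors over the rounds from `r` to `n - 1` that belong to block `k`. -/
def blockProd (r k : ℕ) (l : ℝ) (n : ℕ) : ℝ :=
  ∏ i ∈ Finset.Ico r n, if ω.block q i = k then factor l (ω.dev i) (ω.forecast i).v else 1

variable {q ω}

lemma blockProd_succ {r k n : ℕ} (l : ℝ) (hrn : r ≤ n) (hk : ω.block q n = k) :
    ω.blockProd q r k l (n + 1)
      = ω.blockProd q r k l n * factor l (ω.dev n) (ω.forecast n).v := by
  rw [blockProd, Finset.prod_Ico_succ_top hrn, if_pos hk, blockProd]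

lemma blockProd_eq_one {r k n : ℕ} (l : ℝ) (h : ∀ i < n, ω.block q i < k) :
    ω.blockProd q r k l n = 1 :=
  Finset.prod_eq_one fun i hi => if_neg (h i (Finset.mem_Ico.1 hi).2).ne

lemma AgreeAt.block_eq {n : ℕ} {ω ω' : Path} (hω : Path.AgreeAt n ω ω') {i : ℕ} (hi : i ≤ n + 1) :
    ω.block q i = ω'.block q i := by
  rw [block, block, hω.A_eq hi]

lemma AgreeAt.blockProd_eq {n : ℕ} {ω ω' : Path} (hω : Path.AgreeAt n ω ω') (r k : ℕ) (l : ℝ) :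
    ω.blockProd q r k l n = ω'.blockProd q r k l n := by
  refine Finset.prod_congr rfl fun i hi => ?_
  have hi := (Finset.mem_Ico.1 hi).2
  rw [hω.block_eq (by omega), hω.dev_eq hi, hω.1 i hi.le]

/-- What a path that violates the lower bound satisfies from a suitable round `r` on. -/
structure Violates (ω : Path) (η : ℝ) (q r : ℕ) : Prop where
  exp_le : ∀ n ≥ r, Real.exp (Real.exp 1) ≤ ω.A n
  -- The constant `2 * q` is the `D` of `exp_le_prod_factor_le_exp`; the next bound makes the total
  -- error in the exponent at most `1`.
  err_le : ∀ n ≥ r, ω.err n ≤ (1 / (4 * (2 * q))) ^ 3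
  sum_err_le : ∀ n, ∑ i ∈ Finset.Ico r n, ω.err i ≤ 1 / (8 * (2 * q) ^ 3)
  T_le : ∀ n ≥ r, ω.T n ≤ (1 - η) * √(2 * ω.A n * loglog (ω.A n))
  neg_T_le : ∀ n ≥ r, -ω.T n ≤ 2 * √(2 * ω.A n * loglog (ω.A n))
  A_le : ω.A r ≤ 2 * q ^ ω.block q r
  le_loglog : ∀ k ≥ ω.block q r, 8 ≤ η ^ 2 * loglog ((q : ℝ) ^ (k + 1))

namespace Violates

variable {η : ℝ} {r : ℕ} (hv : ω.Violates η q r) (hη : 0 < η) (hη1 : η ≤ 1)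
  (hq : 800 ≤ q * η ^ 2)

include hη hη1 hq in
lemma _root_.UFQSH.le_of_mul_sq_le : (800 : ℝ) ≤ q := by
  have : (q : ℝ) * η ^ 2 ≤ q := mul_le_of_le_one_right (by positivity) (pow_le_one₀ hη.le hη1)
  linarith

include hv

lemma one_le_A {n : ℕ} (hn : r ≤ n) : 1 ≤ ω.A n := by
  have h1 := hv.exp_le n hn
  have h2 := Real.add_one_le_exp (Real.exp 1)
  have h3 := Real.exp_pos 1
  linarith

lemma A_succ_le (hq : (800 : ℝ) ≤ q) {n : ℕ} (hn : r ≤ n) : ω.A (n + 1) ≤ 2 * ω.A n := by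
  refine A_succ_le_two_mul (hv.exp_le _ (by omega)) ((hv.err_le n hn).trans ?_)
  gcongr
  linarith

lemma exp_le_pow (hq : (800 : ℝ) ≤ q) {n : ℕ} (hn : r ≤ n) :
    Real.exp (Real.exp 1) ≤ (q : ℝ) ^ (ω.block q n + 1) :=
  (hv.exp_le n hn).trans (lt_pow_block (by exact_mod_cast (by linarith : (1 : ℝ) < q)) n).le

lemma block_succ_le (hq : (800 : ℝ) ≤ q) {n : ℕ} (hn : r ≤ n) :
    ω.block q (n + 1) ≤ ω.block q n + 1 := by
  have hq1 : 1 < q := by exact_mod_cast (by linarith : (1 : ℝ) < q)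
  by_contra! hc
  have h1 := (le_block_iff hq1 (hv.one_le_A (by omega : r ≤ n + 1))).1 (Nat.succ_le_of_lt hc)
  have h2 := hv.A_succ_le hq hn
  have h3 := lt_pow_block (ω := ω) hq1 n
  have h4 : (0 : ℝ) < (q : ℝ) ^ (ω.block q n + 1) := by positivity
  rw [Nat.succ_eq_add_one, pow_succ] at h1
  nlinarith

/-- Let `m` be the first round from `r` on in the block of `n`. The variance at most doubles in a
round, so `m` lies near the lower end of the block. -/
lemma exists_block_start (hq : (800 : ℝ) ≤ q) {n : ℕ} (hn : r ≤ n) :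
    ∃ m, r ≤ m ∧ m ≤ n ∧ ω.A m ≤ 2 * q ^ ω.block q n ∧
      ∀ n' ≥ n, (∀ i < n', ω.block q i ≤ ω.block q n) → ∀ l,
        ω.blockProd q r (ω.block q n) l n'
          = ∏ i ∈ Finset.Ico m n', factor l (ω.dev i) (ω.forecast i).v := by
  classical
  have hq1 : 1 < q := by exact_mod_cast (by linarith : (1 : ℝ) < q)
  have hex : ∃ m, r ≤ m ∧ ω.block q m = ω.block q n := ⟨n, hn, rfl⟩
  set m := Nat.find hex with hm
  obtain ⟨hrm, hmk⟩ := Nat.find_spec hex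
  have hmn : m ≤ n := Nat.find_min' hex ⟨hn, rfl⟩
  refine ⟨m, hrm, hmn, ?_, fun n' hn' hb l => ?_⟩
  · rcases hrm.eq_or_lt with e | hlt
    · have hmr : m = r := e.symm
      rw [← hmk]
      change ω.A m ≤ 2 * q ^ ω.block q m
      rw [hmr]
      exact hv.A_le
    · obtain ⟨j, hj⟩ : ∃ j, m = j + 1 := ⟨m - 1, by omega⟩
      have hrj : r ≤ j := by omega
      have h1 : ω.block q j ≠ ω.block q n := fun hc =>
        Nat.find_min hex (show j < Nat.find hex by omega) ⟨hrj, hc⟩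
      have h2 : ω.block q j ≤ ω.block q n := block_mono (by omega)
      have h3 : ω.A j < (q : ℝ) ^ ω.block q n := by
        by_contra! hc
        have := (le_block_iff hq1 (hv.one_le_A hrj)).2 hc
        omega
      have h4 := hv.A_succ_le hq hrj
      rw [hj]
      linarith
  · rw [blockProd, ← Finset.prod_filter]
    refine Finset.prod_congr ?_ fun _ _ => rfl
    ext i
    simp only [Finset.mem_filter, Finset.mem_Ico]
    constructor
    · rintro ⟨⟨h1, h2⟩, h3⟩
      exact ⟨Nat.find_min' hex ⟨h1, h3⟩, h2⟩
    · rintro ⟨h1, h2⟩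
      refine ⟨⟨hrm.trans h1, h2⟩, le_antisymm (hb i h2) ?_⟩
      rw [← hmk]
      exact block_mono h1

/-- The multiplier of a block is of the order of `1 / b` throughout the block. -/
lemma mul_b_le' (hq : (800 : ℝ) ≤ q) {n i : ℕ} (hn : r ≤ n) (hi : i ≤ n) (hri : r ≤ i) :
    optMul ((q : ℝ) ^ (ω.block q n + 1)) * ω.b (i + 1) ≤ 2 * q := by
  set a := (q : ℝ) ^ (ω.block q n + 1) with ha
  have hq1 : 1 < q := by exact_mod_cast (by linarith : (1 : ℝ) < q)
  have hea : Real.exp (Real.exp 1) ≤ a := hv.exp_le_pow hq hn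
  have ha0 := pos_of_exp_le hea
  have haq : a ≤ a * q := le_mul_of_one_le_right ha0.le (by linarith)
  have hL := one_le_loglog hea
  have hL' := loglog_mono hea haq
  have h1 : ω.A (i + 1) ≤ a * q := by
    have := ω.A_mono (show i + 1 ≤ n + 1 by omega)
    have := hv.A_succ_le hq hn
    have := lt_pow_block (ω := ω) hq1 n
    nlinarith
  have h2 := Path.mul_b_le (l := optMul a) (D := 2 * q) (hv.exp_le (i + 1) (by omega)) h1
    (by positivity) (by
      rw [optMul_sq hea]
      calc 2 * loglog a / a * (a * q / loglog (a * q))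
          = 2 * q * (loglog a / loglog (a * q)) := by field_simp
        _ ≤ 2 * q * 1 := by
          gcongr
          exact (div_le_one (by linarith)).2 hL'
        _ ≤ (2 * q) ^ 2 := by nlinarith)
  rwa [abs_of_nonneg (optMul_nonneg a)] at h2

lemma prod_bounds (hq : (800 : ℝ) ≤ q) {m n n' : ℕ} {l : ℝ} (hn : r ≤ n) (hrm : r ≤ m)
    (hmn : m ≤ n') (hn' : n' ≤ n + 1) (hl : |l| ≤ optMul ((q : ℝ) ^ (ω.block q n + 1))) :
    Real.exp (l * (ω.T n' - ω.T m) - l ^ 2 / 2 * (ω.A n' - ω.A m) - 1)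
      ≤ ∏ i ∈ Finset.Ico m n', factor l (ω.dev i) (ω.forecast i).v ∧
    ∏ i ∈ Finset.Ico m n', factor l (ω.dev i) (ω.forecast i).v
      ≤ Real.exp (l * (ω.T n' - ω.T m) - l ^ 2 / 2 * (ω.A n' - ω.A m) + 1) := by
  have key := Path.exp_le_prod_factor_le_exp (ω := ω) (m := m) (n := n') (l := l) (D := 2 * q)
    (by linarith)
    (fun i hi => hv.exp_le _ (by have := Finset.mem_Ico.1 hi; omega))
    (fun i hi => by
      have := Finset.mem_Ico.1 hi
      refine le_trans ?_ (hv.mul_b_le' hq hn (i := i) (by omega) (by omega))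
      have := ω.b_nonneg (i + 1)
      gcongr)
    (fun i hi => hv.err_le i (by have := Finset.mem_Ico.1 hi; omega)) hmn
  have hs : 8 * (2 * (q : ℝ)) ^ 3 * ∑ i ∈ Finset.Ico m n', ω.err i ≤ 1 := by
    have h1 : ∑ i ∈ Finset.Ico m n', ω.err i ≤ ∑ i ∈ Finset.Ico r n', ω.err i :=
      Finset.sum_le_sum_of_subset_of_nonneg (Finset.Ico_subset_Ico_left hrm)
        fun i _ _ => ω.err_nonneg i
    have h2 := hv.sum_err_le n'
    have h3 : (0 : ℝ) < 8 * (2 * q) ^ 3 := by positivity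
    rw [le_div_iff₀ h3] at h2
    nlinarith
  exact ⟨le_trans (Real.exp_le_exp.2 (by linarith)) key.1,
    key.2.trans (Real.exp_le_exp.2 (by linarith))⟩

lemma sqrt_bounds (hq : (800 : ℝ) ≤ q) {n : ℕ} (hn : r ≤ n) {j : ℕ} (hrj : r ≤ j) (hjn : j ≤ n) :
    optMul ((q : ℝ) ^ (ω.block q n + 1)) * √(2 * ω.A j * loglog (ω.A j))
      ≤ 2 * loglog ((q : ℝ) ^ (ω.block q n + 1)) * √(ω.A j / (q : ℝ) ^ (ω.block q n + 1)) := by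
  set a := (q : ℝ) ^ (ω.block q n + 1) with ha
  have hq1 : 1 < q := by exact_mod_cast (by linarith : (1 : ℝ) < q)
  have hea : Real.exp (Real.exp 1) ≤ a := hv.exp_le_pow hq hn
  have ha0 := pos_of_exp_le hea
  have hL := one_le_loglog hea
  have hj : ω.A j ≤ a := (ω.A_mono hjn).trans (lt_pow_block hq1 n).le
  have hLj := loglog_mono (hv.exp_le j hrj) hj
  have hj0 := ω.A_nonneg j
  calc optMul a * √(2 * ω.A j * loglog (ω.A j))
      ≤ optMul a * √(2 * ω.A j * loglog a) := by
        have := optMul_nonneg a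
        gcongr
    _ = √((2 * loglog a) ^ 2 * (ω.A j / a)) := by
        rw [optMul, ← Real.sqrt_mul (by positivity)]
        congr 1
        field_simp
    _ = 2 * loglog a * √(ω.A j / a) := by
        rw [Real.sqrt_mul (by positivity), Real.sqrt_sq (by positivity)]

include hη hη1 hq in
-- The history before the block is negligible: `2 / q ≤ (η / 20) ^ 2` is the origin of `800`.
-- Control of `-T m` comes from the upper law applied to the negated deviations.
lemma start_bounds {n m : ℕ} (hn : r ≤ n) (hrm : r ≤ m) (hmn : m ≤ n)
    (hm : ω.A m ≤ 2 * q ^ ω.block q n) :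
    √(ω.A m / (q : ℝ) ^ (ω.block q n + 1)) ≤ η / 20 ∧
    -(optMul ((q : ℝ) ^ (ω.block q n + 1)) * ω.T m)
      ≤ 4 * loglog ((q : ℝ) ^ (ω.block q n + 1)) * √(ω.A m / (q : ℝ) ^ (ω.block q n + 1)) := by
  have hq8 := le_of_mul_sq_le hη hη1 hq
  constructor
  · rw [Real.sqrt_le_left (by positivity), div_le_iff₀ (by positivity), pow_succ (q : ℝ)]
    have h1 : (0 : ℝ) < (q : ℝ) ^ ω.block q n := by positivity
    have h2 := mul_le_mul_of_nonneg_right hq h1.le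
    linarith
  · have h1 := hv.sqrt_bounds hq8 hn hrm hmn
    have h2 := mul_le_mul_of_nonneg_left (hv.neg_T_le m hrm)
      (optMul_nonneg ((q : ℝ) ^ (ω.block q n + 1)))
    linarith

include hη hη1 hq in
-- With `α = √(A n / a)`, the exponent is at most `loglog a` times `2 * (1 - η) * α - α ^ 2 ≤ (1 -
-- η) ^ 2`, up to small terms; the price `exp (-loglog a)` outweighs it.
lemma blockProd_le {n : ℕ} (hn : r ≤ n) :
    Real.exp (-loglog ((q : ℝ) ^ (ω.block q n + 1))) *
      ω.blockProd q r (ω.block q n) (optMul ((q : ℝ) ^ (ω.block q n + 1))) n ≤ 1 / 16 := by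
  have hq8 := le_of_mul_sq_le hη hη1 hq
  have hq1 : 1 < q := by exact_mod_cast (by linarith : (1 : ℝ) < q)
  obtain ⟨m, hrm, hmn, hm, hprod⟩ := hv.exists_block_start hq8 hn
  rw [hprod n le_rfl fun i hi => block_mono hi.le]
  obtain ⟨s1, s2⟩ := hv.start_bounds hη hη1 hq hn hrm hmn hm
  have s3 := hv.sqrt_bounds hq8 hn hn le_rfl
  have hea := hv.exp_le_pow hq8 hn
  have hl8 := hv.le_loglog _ (block_mono hn)
  have hAn := lt_pow_block (ω := ω) hq1 n
  set a := (q : ℝ) ^ (ω.block q n + 1) with ha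
  have ha0 := pos_of_exp_le hea
  have hL := one_le_loglog hea
  set l := optMul a with hl
  have l0 : 0 ≤ l := optMul_nonneg a
  have hp := (hv.prod_bounds hq8 (l := l) hn hrm hmn n.le_succ (abs_of_nonneg l0).le).2
  have hl2 : l ^ 2 / 2 = loglog a / a := by rw [hl, optMul_sq hea]; ring
  set α := √(ω.A n / a) with hα
  set β := √(ω.A m / a) with hβ
  have α2 : α ^ 2 = ω.A n / a := Real.sq_sqrt (div_nonneg (ω.A_nonneg n) ha0.le)
  have β2 : β ^ 2 = ω.A m / a := Real.sq_sqrt (div_nonneg (ω.A_nonneg m) ha0.le)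
  have α0 : 0 ≤ α := Real.sqrt_nonneg _
  have β0 : 0 ≤ β := Real.sqrt_nonneg _
  have e1 : l ^ 2 / 2 * (ω.A n - ω.A m) = loglog a * (α ^ 2 - β ^ 2) := by
    rw [hl2, α2, β2]
    ring
  have e2 : l * ω.T n ≤ loglog a * (2 * (1 - η) * α) := by
    have h1 := mul_le_mul_of_nonneg_left (hv.T_le n hn) l0
    have h2 := mul_le_mul_of_nonneg_left s3 (sub_nonneg.2 hη1)
    linarith
  have e3 : l * (ω.T n - ω.T m) - l ^ 2 / 2 * (ω.A n - ω.A m) + 1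
      ≤ loglog a * (1 - η / 2) + 1 := by
    have h1 : 2 * (1 - η) * α - α ^ 2 + 4 * β + β ^ 2 ≤ 1 - η / 2 := by
      nlinarith [sq_nonneg (α - (1 - η))]
    have h2 := mul_le_mul_of_nonneg_left h1 (by linarith : 0 ≤ loglog a)
    rw [e1]
    linarith
  have e4 : 8 ≤ η * loglog a := by nlinarith
  calc Real.exp (-loglog a) * _ ≤ Real.exp (-loglog a) * Real.exp (loglog a * (1 - η / 2) + 1) := by
        gcongr
        exact hp.trans (Real.exp_le_exp.2 e3)
    _ ≤ Real.exp (-3) := by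
        rw [← Real.exp_add]
        exact Real.exp_le_exp.2 (by linarith)
    _ ≤ 1 / 16 := by
        rw [Real.exp_neg, inv_eq_one_div]
        refine one_div_le_one_div_of_le (by norm_num) ?_
        have h1 := Real.exp_one_gt_d9
        have h2 : Real.exp 3 = Real.exp 1 ^ 3 := by rw [← Real.exp_nat_mul]; norm_num
        rw [h2]
        calc (16 : ℝ) ≤ 2.7 ^ 3 := by norm_num
          _ ≤ Real.exp 1 ^ 3 := by gcongr; linarith

include hη hη1 hq in
-- At the end of the block the variance has reached `a`, and for so small a deviation the multiplier
-- `(1 - η) * l` beats `l`. The exponents differ by at least `3`, of which the two approximation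
-- errors take at most `2`.
lemma two_mul_blockProd_le {n : ℕ} (hn : r ≤ n) (hb : ω.block q (n + 1) ≠ ω.block q n) :
    2 * ω.blockProd q r (ω.block q n) (optMul ((q : ℝ) ^ (ω.block q n + 1))) (n + 1)
      ≤ ω.blockProd q r (ω.block q n) ((1 - η) * optMul ((q : ℝ) ^ (ω.block q n + 1))) (n + 1) := by
  have hq8 := le_of_mul_sq_le hη hη1 hq
  have hq1 : 1 < q := by exact_mod_cast (by linarith : (1 : ℝ) < q)
  obtain ⟨m, hrm, hmn, hm, hprod⟩ := hv.exists_block_start hq8 hn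
  have hle : ∀ i < n + 1, ω.block q i ≤ ω.block q n := fun i hi => block_mono (by omega)
  rw [hprod (n + 1) n.le_succ hle, hprod (n + 1) n.le_succ hle]
  obtain ⟨s1, s2⟩ := hv.start_bounds hη hη1 hq hn hrm hmn hm
  have s3 := hv.sqrt_bounds hq8 hn hn le_rfl
  have hea := hv.exp_le_pow hq8 hn
  have hl8 := hv.le_loglog _ (block_mono hn)
  have hAn := lt_pow_block (ω := ω) hq1 n
  have hAn' : (q : ℝ) ^ (ω.block q n + 1) ≤ ω.A (n + 1) := by
    refine (le_block_iff hq1 (hv.one_le_A (by omega))).1 ?_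
    have : ω.block q n ≤ ω.block q (n + 1) := block_mono n.le_succ
    omega
  have hdev : |ω.dev n| ≤ 1 / (4 * (2 * q)) * ω.b (n + 1) :=
    abs_dev_le (hv.exp_le _ (by omega)) (by positivity) (hv.err_le n hn)
  have hmul := hv.mul_b_le' hq8 hn le_rfl hn
  set a := (q : ℝ) ^ (ω.block q n + 1) with ha
  have ha0 := pos_of_exp_le hea
  have hL := one_le_loglog hea
  set l := optMul a with hl
  have l0 : 0 ≤ l := optMul_nonneg a
  have hp1 := (hv.prod_bounds hq8 (l := l) hn hrm (by omega : m ≤ n + 1) le_rfl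
    (abs_of_nonneg l0).le).2
  have hp2 := (hv.prod_bounds hq8 (l := (1 - η) * l) hn hrm (by omega : m ≤ n + 1) le_rfl (by
    rw [abs_of_nonneg (mul_nonneg (sub_nonneg.2 hη1) l0)]
    exact mul_le_of_le_one_left l0 (by linarith))).1
  have hl2 : l ^ 2 / 2 = loglog a / a := by rw [hl, optMul_sq hea]; ring
  set α := √(ω.A n / a) with hα
  set β := √(ω.A m / a) with hβ
  have β2 : β ^ 2 = ω.A m / a := Real.sq_sqrt (div_nonneg (ω.A_nonneg m) ha0.le)
  have α1 : α ≤ 1 := by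
    exact Real.sqrt_le_one.2 ((div_le_one ha0).2 hAn.le)
  have β0 : 0 ≤ β := Real.sqrt_nonneg _
  have e1 : loglog a * (1 - β ^ 2) ≤ l ^ 2 / 2 * (ω.A (n + 1) - ω.A m) := by
    rw [hl2, β2, div_mul_eq_mul_div, mul_div_assoc]
    gcongr
    rw [sub_div]
    gcongr
    exact (one_le_div ha0).2 hAn'
  have e2 : l * ω.T n ≤ loglog a * (2 * (1 - η)) := by
    have h1 := mul_le_mul_of_nonneg_left (hv.T_le n hn) l0
    have h2 := mul_le_mul_of_nonneg_left s3 (sub_nonneg.2 hη1)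
    have h3 : 2 * loglog a * α ≤ 2 * loglog a * 1 := by gcongr
    have h4 := mul_le_mul_of_nonneg_left h3 (sub_nonneg.2 hη1)
    linarith
  -- The bound on `T` is used at `n`, where `A n < a`; this is the effect of the round that leaves
  -- the block.
  have e3 : l * ω.dev n ≤ 1 / 4 := by
    calc l * ω.dev n ≤ l * (1 / (4 * (2 * q)) * ω.b (n + 1)) := by
          have := le_abs_self (ω.dev n)
          gcongr
          linarith
      _ = l * ω.b (n + 1) * (1 / (4 * (2 * q))) := by ring
      _ ≤ 2 * q * (1 / (4 * (2 * q))) := by gcongr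
      _ = 1 / 4 := by field_simp
  have hX : l * (ω.T (n + 1) - ω.T m) ≤ loglog a * (2 * (1 - η) + 4 * β) + 1 / 4 := by
    rw [ω.T_succ]
    linarith
  set X := l * (ω.T (n + 1) - ω.T m) with hXd
  set Y := l ^ 2 / 2 * (ω.A (n + 1) - ω.A m) with hYd
  have e4 : (1 - η) * l * (ω.T (n + 1) - ω.T m) - ((1 - η) * l) ^ 2 / 2 * (ω.A (n + 1) - ω.A m) - 1
      = (1 - η) * X - (1 - η) ^ 2 * Y - 1 := by rw [hXd, hYd]; ring
  rw [e4] at hp2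
  have hfin : η * X - (2 * η - η ^ 2) * Y ≤ -3 :=
    block_end_exponent_le hη.le hη1 β0 s1 (by linarith) hl8 hX e1

  refine le_trans ?_ hp2
  calc 2 * ∏ i ∈ Finset.Ico m (n + 1), factor l (ω.dev i) (ω.forecast i).v
      ≤ Real.exp 1 * Real.exp (X - Y + 1) := by
        have := Real.add_one_le_exp (1 : ℝ)
        have h0 := (Real.exp_pos _).le.trans (hv.prod_bounds hq8 (l := l) hn hrm
          (by omega : m ≤ n + 1) le_rfl (abs_of_nonneg l0).le).1
        gcongr
        linarith
    _ ≤ _ := by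
        rw [← Real.exp_add]
        exact Real.exp_le_exp.2 (by linarith)

end Violates

end Path

/-! ### The hedged bets over geometric blocks -/

/-- The price Skeptic asks for the bet of block `k`. -/
def blockPrice (q k : ℕ) : ℝ := Real.exp (-loglog ((q : ℝ) ^ (k + 1)))

/-- The price is `1 / ((k + 1) * log q)`, a harmonic series. -/
lemma not_summable_blockPrice {q : ℕ} (hq : 1 < q) : ¬ Summable (blockPrice q) := by
  have hl : 0 < Real.log q := Real.log_pos (by exact_mod_cast hq)
  intro hs
  have h1 : Summable fun k : ℕ => 1 / ((k : ℝ) + 1) := by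
    refine (hs.mul_right (Real.log q)).congr fun k => ?_
    rw [blockPrice, loglog_pow, Real.exp_neg, Real.exp_log (by positivity)]
    push_cast
    field_simp
  have h2 : Summable fun k : ℕ => 1 / (k : ℝ) := by
    refine (summable_nat_add_iff 1).1 ?_
    simpa using h1
  exact Real.not_summable_one_div_natCast h2

/-- The stakes against the upward deviations of the martingale in each block, protected by the extra
hedge against large outcomes. -/
def lowerStake (h : ℝ → ℝ) (η : ℝ) (q r n : ℕ) (ω : Path) : Stake where
  M := -(blockPrice q (ω.block q n) *
    (2 * (optMul ((q : ℝ) ^ (ω.block q n + 1)) *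
        ω.blockProd q r (ω.block q n) (optMul ((q : ℝ) ^ (ω.block q n + 1))) n)
      - (1 - η) * optMul ((q : ℝ) ^ (ω.block q n + 1)) *
        ω.blockProd q r (ω.block q n) ((1 - η) * optMul ((q : ℝ) ^ (ω.block q n + 1))) n))
  V := -(blockPrice q (ω.block q n) *
    (2 * (optMul ((q : ℝ) ^ (ω.block q n + 1)) ^ 2 / 2 *
        ω.blockProd q r (ω.block q n) (optMul ((q : ℝ) ^ (ω.block q n + 1))) n)
      - ((1 - η) * optMul ((q : ℝ) ^ (ω.block q n + 1))) ^ 2 / 2 *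
        ω.blockProd q r (ω.block q n) ((1 - η) * optMul ((q : ℝ) ^ (ω.block q n + 1))) n))
  W := (2 * q) ^ 3 / h (ω.b (n + 1))

lemma predictable_lowerStake (h : ℝ → ℝ) (η : ℝ) (q r : ℕ) : Predictable (lowerStake h η q r) := by
  intro n ω ω' hω
  unfold lowerStake
  rw [hω.block_eq n.le_succ, hω.blockProd_eq, hω.blockProd_eq, hω.b_eq le_rfl]

/-- The part of the gain of `lowerStake` that comes from the linear and quadratic bets. -/
def blockGain (η : ℝ) (q r n : ℕ) (ω : Path) (y : ℝ) : ℝ :=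
  -(blockPrice q (ω.block q n) *
    (2 * (ω.blockProd q r (ω.block q n) (optMul ((q : ℝ) ^ (ω.block q n + 1))) n *
        (factor (optMul ((q : ℝ) ^ (ω.block q n + 1))) y (ω.forecast n).v - 1))
      - ω.blockProd q r (ω.block q n) ((1 - η) * optMul ((q : ℝ) ^ (ω.block q n + 1))) n *
        (factor ((1 - η) * optMul ((q : ℝ) ^ (ω.block q n + 1))) y (ω.forecast n).v - 1)))

lemma gain_lowerStake (h : ℝ → ℝ) (η : ℝ) (q r n : ℕ) (ω : Path) (x : ℝ) :
    gain h (ω.forecast n) (lowerStake h η q r n ω) x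
      = blockGain η q r n ω (x - (ω.forecast n).m)
        + (2 * q) ^ 3 * (h (x - (ω.forecast n).m) / h (ω.b (n + 1)) - ω.hedgePrice h n) := by
  simp only [gain, lowerStake, blockGain, factor, Path.hedgePrice]
  ring

namespace Path.Violates

variable {η : ℝ} {q r : ℕ} {ω : Path} (hv : ω.Violates η q r) (hη : 0 < η) (hη1 : η ≤ 1)
  (hq : 800 ≤ q * η ^ 2)

include hv hη hη1 hq

lemma mul_sq_le_one {n : ℕ} (hn : r ≤ n) {l : ℝ}
    (hl : |l| ≤ optMul ((q : ℝ) ^ (ω.block q n + 1))) : l ^ 2 * (ω.forecast n).v ≤ 1 := by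
  have hq8 := le_of_mul_sq_le hη hη1 hq
  refine Path.sq_mul_v_le_one (D := 2 * q) (hv.exp_le _ (by omega)) (by linarith) ?_
    (hv.err_le n hn)
  refine le_trans ?_ (hv.mul_b_le' hq8 hn le_rfl hn)
  have := ω.b_nonneg (n + 1)
  gcongr

omit hv hq in
lemma _root_.UFQSH.abs_one_sub_mul_le (a : ℝ) : |(1 - η) * optMul a| ≤ optMul a := by
  have := optMul_nonneg a
  rw [abs_of_nonneg (mul_nonneg (sub_nonneg.2 hη1) this)]
  exact mul_le_of_le_one_left this (by linarith)

lemma blockProd_nonneg {n : ℕ} {l : ℝ}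
    (hl : |l| ≤ optMul ((q : ℝ) ^ (ω.block q n + 1))) :
    0 ≤ ω.blockProd q r (ω.block q n) l n := by
  refine Finset.prod_nonneg fun i hi => ?_
  split_ifs with hb
  · exact factor_nonneg (hv.mul_sq_le_one hη hη1 hq (Finset.mem_Ico.1 hi).1 (by rwa [hb]))
  · exact zero_le_one

/-- Within a block the gains telescope to `p * (1 - 2 * E₁ + E₂)`, which is `0` at the start, where
both products are `1`. At the end `2 * E₁ ≤ E₂` leaves at least `p`. -/
lemma sum_blockGain_ge {n : ℕ} (hn : r ≤ n) :
    ∑ k ∈ Finset.Ico (ω.block q r) (ω.block q n), blockPrice q k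
      + blockPrice q (ω.block q n) *
        (1 - 2 * ω.blockProd q r (ω.block q n) (optMul ((q : ℝ) ^ (ω.block q n + 1))) n
          + ω.blockProd q r (ω.block q n) ((1 - η) * optMul ((q : ℝ) ^ (ω.block q n + 1))) n)
      ≤ ∑ i ∈ Finset.Ico r n, blockGain η q r i ω (ω.dev i) := by
  have hq8 := le_of_mul_sq_le hη hη1 hq
  induction n, hn using Nat.le_induction with
  | base => simp [Path.blockProd]; linarith
  | succ n hn ih =>
    have hp : 0 < blockPrice q (ω.block q n) := Real.exp_pos _
    have s1 := Path.blockProd_succ (optMul ((q : ℝ) ^ (ω.block q n + 1))) hn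
      (rfl : ω.block q n = _)
    have s2 := Path.blockProd_succ ((1 - η) * optMul ((q : ℝ) ^ (ω.block q n + 1))) hn
      (rfl : ω.block q n = _)
    rw [Finset.sum_Ico_succ_top hn]
    have hg : blockGain η q r n ω (ω.dev n) = blockPrice q (ω.block q n) *
        (2 * ω.blockProd q r (ω.block q n) (optMul ((q : ℝ) ^ (ω.block q n + 1))) n
          - ω.blockProd q r (ω.block q n) ((1 - η) * optMul ((q : ℝ) ^ (ω.block q n + 1))) n
          - 2 * ω.blockProd q r (ω.block q n) (optMul ((q : ℝ) ^ (ω.block q n + 1))) (n + 1)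
          + ω.blockProd q r (ω.block q n) ((1 - η) * optMul ((q : ℝ) ^ (ω.block q n + 1)))
            (n + 1)) := by
      rw [s1, s2, blockGain]
      ring
    by_cases hb : ω.block q (n + 1) = ω.block q n
    · rw [hb]
      linarith
    · have h1 := hv.two_mul_blockProd_le hη hη1 hq hn hb
      have h2 := hv.block_succ_le hq8 hn
      have h3 : ω.block q n ≤ ω.block q (n + 1) := Path.block_mono n.le_succ
      have h4 : ω.block q (n + 1) = ω.block q n + 1 := by omega
      have h5 : ∀ i < n + 1, ω.block q i < ω.block q (n + 1) := fun i hi => by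
        have : ω.block q i ≤ ω.block q n := Path.block_mono (by omega)
        omega
      have h6 : ω.block q r ≤ ω.block q n := Path.block_mono hn
      rw [Path.blockProd_eq_one _ h5, Path.blockProd_eq_one _ h5, h4, Finset.sum_Ico_succ_top h6]
      have h7 := mul_le_mul_of_nonneg_left h1 hp.le
      linarith

/-- Against a violation of the lower bound, `lowerStake` is safe and makes Skeptic rich. -/
lemma lowerStake_spec {h : ℝ → ℝ} (hh : IsExtraHedge h) (hA : Tendsto ω.A atTop atTop)
    (hz : ∀ n, ∑ i ∈ Finset.Ico r n, ω.hedgePrice h i ≤ 1 / (4 * (2 * q) ^ 3)) :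
    (∀ n ≥ r, ∀ x, 0 ≤ 1 + ∑ i ∈ Finset.Ico r n,
        gain h (ω.forecast i) (lowerStake h η q r i ω) (ω.outcome i)
        + gain h (ω.forecast n) (lowerStake h η q r n ω) x) ∧
      Tendsto (fun n => 1 + ∑ i ∈ Finset.Ico r n,
        gain h (ω.forecast i) (lowerStake h η q r i ω) (ω.outcome i)) atTop atTop := by
  have hq8 := le_of_mul_sq_le hη hη1 hq
  have hq1 : 1 < q := by exact_mod_cast (by linarith : (1 : ℝ) < q)
  have hz' : ∀ n, (2 * (q : ℝ)) ^ 3 * ∑ i ∈ Finset.Ico r n, ω.hedgePrice h i ≤ 1 / 4 := fun n => by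
    have h1 : (0 : ℝ) < (2 * q) ^ 3 := by positivity
    have := mul_le_mul_of_nonneg_left (hz n) h1.le
    refine this.trans_eq ?_
    field_simp
  have hsum : ∀ n, ∑ i ∈ Finset.Ico r n, blockGain η q r i ω (ω.dev i)
      - (2 * (q : ℝ)) ^ 3 * ∑ i ∈ Finset.Ico r n, ω.hedgePrice h i
      ≤ ∑ i ∈ Finset.Ico r n,
        gain h (ω.forecast i) (lowerStake h η q r i ω) (ω.outcome i) := fun n => by
    rw [Finset.mul_sum, ← Finset.sum_sub_distrib]
    refine Finset.sum_le_sum fun i _ => ?_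
    have h1 := hedgePayoff_nonneg hh ω i
    have h2 : (0 : ℝ) ≤ (2 * q) ^ 3 := by positivity
    have h3 := mul_nonneg h2 h1
    rw [gain_lowerStake]
    simp only [Path.hedgePayoff, Path.dev] at h3 ⊢
    linarith
  have hpp : ∀ n, 0 ≤ ∑ k ∈ Finset.Ico (ω.block q r) (ω.block q n), blockPrice q k :=
    fun n => Finset.sum_nonneg fun k _ => (Real.exp_pos _).le
  have hE1 : ∀ n ≥ r, blockPrice q (ω.block q n) *
      ω.blockProd q r (ω.block q n) (optMul ((q : ℝ) ^ (ω.block q n + 1))) n ≤ 1 / 16 :=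
    fun n hn => hv.blockProd_le hη hη1 hq hn
  have hE2 : ∀ n ≥ r, 0 ≤ blockPrice q (ω.block q n) *
      ω.blockProd q r (ω.block q n) ((1 - η) * optMul ((q : ℝ) ^ (ω.block q n + 1))) n :=
    fun n hn => mul_nonneg (Real.exp_pos _).le
      (hv.blockProd_nonneg hη hη1 hq (abs_one_sub_mul_le hη hη1 _))
  constructor
  · intro n hn x
    have h1 := hv.sum_blockGain_ge hη hη1 hq hn
    have h2 := hsum n
    have h3 := hz' (n + 1)
    rw [Finset.sum_Ico_succ_top hn] at h3
    have h4 := hpp n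
    have hp : 0 < blockPrice q (ω.block q n) := Real.exp_pos _
    have hmul := hv.mul_b_le' hq8 hn le_rfl hn
    have hb : 0 < ω.b (n + 1) := Path.b_pos (hv.exp_le _ (by omega))
    rw [gain_lowerStake, blockGain]
    set y := x - (ω.forecast n).m
    set l := optMul ((q : ℝ) ^ (ω.block q n + 1)) with hl
    have l0 : 0 ≤ l := optMul_nonneg _
    set p := blockPrice q (ω.block q n)
    set E₁ := ω.blockProd q r (ω.block q n) l n with hE₁
    set E₂ := ω.blockProd q r (ω.block q n) ((1 - η) * l) n
    have h5 : 0 ≤ p * E₁ := mul_nonneg hp.le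
      (hv.blockProd_nonneg hη hη1 hq (abs_of_nonneg l0).le)
    have h6 : p * E₁ ≤ 1 / 16 := hE1 n hn
    have h7 : 0 ≤ p * E₂ := hE2 n hn
    have h8 : 0 ≤ factor ((1 - η) * l) y (ω.forecast n).v :=
      factor_nonneg (hv.mul_sq_le_one hη hη1 hq hn (abs_one_sub_mul_le hη hη1 _))
    have h9 : factor l y (ω.forecast n).v ≤ 3 / 2 + (l * y) ^ 2 := by
      have := mul_nonneg (sq_nonneg l) (ω.forecast n).v_nonneg
      unfold factor
      nlinarith [sq_nonneg (l * y - 1)]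
    -- Here `x` is arbitrary, so `y` may be huge. If `l * |y| ≥ 1` then `|y| ≥ b / (2 * q)`, and
    -- `sq_le` costs `2 * q` besides the `(2 * q) ^ 2` from `l * b ≤ 2 * q`; hence the coefficient
    -- in `W`.
    have h10 : (l * y) ^ 2 ≤ 1 + (2 * q) ^ 3 * (h y / h (ω.b (n + 1))) := by
      have hr : 0 ≤ h y / h (ω.b (n + 1)) := div_nonneg (hh.nonneg _) (hh.nonneg _)
      rcases le_total (l * |y|) 1 with hc | hc
      · have e : (l * y) ^ 2 ≤ 1 := by
          rw [← sq_abs, abs_mul, abs_of_nonneg l0]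
          exact pow_le_one₀ (by positivity) hc
        have : 0 ≤ (2 * (q : ℝ)) ^ 3 * (h y / h (ω.b (n + 1))) := by positivity
        linarith
      · have c1 : ω.b (n + 1) ≤ 2 * q * |y| := by
          calc ω.b (n + 1) ≤ ω.b (n + 1) * (l * |y|) := le_mul_of_one_le_right hb.le hc
            _ = l * ω.b (n + 1) * |y| := by ring
            _ ≤ _ := by gcongr
        have c2 := hh.sq_le (D := 2 * q) hb (by linarith) c1
        calc (l * y) ^ 2 = (l * ω.b (n + 1)) ^ 2 * (y / ω.b (n + 1)) ^ 2 := by field_simp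
          _ ≤ (2 * q) ^ 2 * (2 * q * (h y / h (ω.b (n + 1)))) := by gcongr
          _ = (2 * q) ^ 3 * (h y / h (ω.b (n + 1))) := by ring
          _ ≤ _ := by linarith
    have hZ : 0 ≤ (2 * q) ^ 3 * (h y / h (ω.b (n + 1))) :=
      mul_nonneg (by positivity) (div_nonneg (hh.nonneg _) (hh.nonneg _))
    set Z := (2 * q) ^ 3 * (h y / h (ω.b (n + 1))) with hZd
    -- Twice this is `5 / 16 + Z / 8`, less than the available `3 / 4 + Z`: the initial `1` minus
    -- the hedge prices, plus the hedge payoff.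
    have h11 : p * E₁ * factor l y (ω.forecast n).v ≤ 1 / 16 * (5 / 2 + Z) := by
      calc p * E₁ * factor l y (ω.forecast n).v ≤ p * E₁ * (5 / 2 + Z) := by
            gcongr
            linarith
        _ ≤ _ := by gcongr
    have h12 := mul_nonneg h7 h8
    have h13 : (2 * (q : ℝ)) ^ 3 * (h y / h (ω.b (n + 1)) - ω.hedgePrice h n)
        = Z - (2 * q) ^ 3 * ω.hedgePrice h n := by rw [hZd]; ring
    rw [h13]
    linarith
  · have ht := (tendsto_sum_Ico_of_not_summable (f := blockPrice q) (fun k => (Real.exp_pos _).le)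
      (not_summable_blockPrice hq1) (ω.block q r)).comp (Path.tendsto_block hq1 hA)
    refine tendsto_atTop_mono' _ ?_ ht
    filter_upwards [eventually_ge_atTop r] with n hn
    have h1 := hv.sum_blockGain_ge hη hη1 hq hn
    have h2 := hsum n
    have h3 := hz' n
    have h4 := hE1 n hn
    have h5 := hE2 n hn
    have hp : 0 < blockPrice q (ω.block q n) := Real.exp_pos _
    simp only [Function.comp]
    linarith

end Path.Violates

lemma exists_violates {η : ℝ} {q : ℕ} (hη : 0 < η) (hq : (800 : ℝ) ≤ q) {ω : Path}
    (hA : Tendsto ω.A atTop atTop) (he : Summable ω.err)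
    (hlo : ∀ᶠ n in atTop, -ω.T n ≤ 2 * √(2 * ω.A n * loglog (ω.A n)))
    (hup : ∀ᶠ n in atTop, ω.T n ≤ (1 - η) * √(2 * ω.A n * loglog (ω.A n))) (r₀ : ℕ) :
    ∃ r ≥ r₀, ω.Violates η q r := by
  have hq1 : 1 < q := by exact_mod_cast (by linarith : (1 : ℝ) < q)
  obtain ⟨N₁, hN₁⟩ := ((hA.eventually_ge_atTop (Real.exp (Real.exp 1))).and
    ((he.tendsto_atTop_zero.eventually_le_const
      (show (0 : ℝ) < (1 / (4 * (2 * q))) ^ 3 by positivity)).and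
        (hlo.and hup))).exists_forall_of_atTop
  obtain ⟨N₂, hN₂⟩ := exists_forall_sum_Ico_le ω.err_nonneg he
    (show (0 : ℝ) < 1 / (8 * (2 * q) ^ 3) by positivity)
  set N := max r₀ (max N₁ N₂) with hN
  have hpow := tendsto_pow_atTop_atTop_of_one_lt (by exact_mod_cast hq1 : (1 : ℝ) < q)
  have hll := ((tendsto_loglog.comp
    ((tendsto_add_atTop_iff_nat 1).2 hpow)).const_mul_atTop (by positivity : 0 < η ^ 2))
  obtain ⟨k₁, hk₁⟩ := (hll.eventually_ge_atTop 8).exists_forall_of_atTop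
  obtain ⟨k, hk, hkA⟩ := ((eventually_ge_atTop k₁).and
    (hpow.eventually_gt_atTop (ω.A N))).exists
  have hex : ∃ n, (q : ℝ) ^ k ≤ ω.A n := (hA.eventually_ge_atTop _).exists
  classical
  -- Starting when `A` first reaches `q ^ k` puts `r` near the lower end of its block, as `A` at
  -- most doubles in a round.
  set r := Nat.find hex with hr
  have hrA : (q : ℝ) ^ k ≤ ω.A r := Nat.find_spec hex
  have hNr : N < r := by
    by_contra! hc
    have := ω.A_mono hc
    linarith
  have hA1 : 1 ≤ ω.A r := (one_le_pow₀ (by linarith)).trans hrA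
  have hkb : k ≤ ω.block q r := (Path.le_block_iff hq1 hA1).2 hrA
  have hg := fun n (hn : r ≤ n) => hN₁ n (by omega)
  refine ⟨r, by omega, fun n hn => (hg n hn).1, fun n hn => (hg n hn).2.1,
    hN₂ r (by omega), fun n hn => (hg n hn).2.2.2, fun n hn => (hg n hn).2.2.1, ?_,
    fun j hj => hk₁ j (by omega)⟩
  obtain ⟨j, hj⟩ : ∃ j, r = j + 1 := ⟨r - 1, by omega⟩
  have h1 : ω.A j < (q : ℝ) ^ k := by
    have := Nat.find_min hex (show j < Nat.find hex by omega)
    exact not_le.1 this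
  have h2 : ω.A (j + 1) ≤ 2 * ω.A j := by
    refine Path.A_succ_le_two_mul (hj ▸ (hg r le_rfl).1) ((hN₁ j (by omega)).2.1.trans ?_)
    gcongr
    linarith
  have h3 : (q : ℝ) ^ k ≤ (q : ℝ) ^ ω.block q r := pow_le_pow_right₀ (by linarith) hkb
  rw [← hj] at h2
  linarith

/-- The lower bound in the law of the iterated logarithm. -/
lemma forceable_lower {h : ℝ → ℝ} (hh : IsExtraHedge h) {η : ℝ} (hη : 0 < η) (hη1 : η ≤ 1) :
    Forceable h {ω | Tendsto ω.A atTop atTop → Summable (ω.hedgePrice h) → Summable ω.err →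
      (∀ᶠ n in atTop, -ω.T n ≤ 2 * √(2 * ω.A n * loglog (ω.A n))) →
      ∃ᶠ n in atTop, (1 - η) * √(2 * ω.A n * loglog (ω.A n)) < ω.T n} := by
  obtain ⟨q, hq'⟩ := exists_nat_ge (800 / η ^ 2)
  have hq : 800 ≤ q * η ^ 2 := (div_le_iff₀ (by positivity)).1 hq'
  have hq8 := le_of_mul_sq_le hη hη1 hq
  choose s hp h0 hn hw using fun r => exists_safe h (predictable_lowerStake h η q r) r
  refine forceable_of_seq s hp h0 hn fun ω hω r₀ => ?_
  simp only [Set.mem_ofPred_eq, Classical.not_imp, not_frequently, not_lt] at hω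
  obtain ⟨hA, hz, he, hlo, hup⟩ := hω
  obtain ⟨N, hN⟩ := exists_forall_sum_Ico_le (hedgePrice_nonneg hh ω) hz
    (show (0 : ℝ) < 1 / (4 * (2 * q) ^ 3) by positivity)
  obtain ⟨r, hr, hv⟩ := exists_violates hη hq8 hA he hlo hup (max r₀ N)
  obtain ⟨h1, h2⟩ := hv.lowerStake_spec hη hη1 hq hh hA (hN r (by omega))
  refine ⟨r, by omega, h2.congr' ?_⟩
  filter_upwards [eventually_ge_atTop r] with n hnr
  exact (hw r ω h1 n hnr).symm

/-! ### The law of the iterated logarithm -/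

/-- The bounds for all positive `η` determine the upper limit. -/
lemma limsup_eq_one {ω : Path} (hA : Tendsto ω.A atTop atTop)
    (hup : ∀ j : ℕ, ∀ᶠ n in atTop,
      ω.T n ≤ (1 + 1 / ((j : ℝ) + 1)) * √(2 * ω.A n * loglog (ω.A n)))
    (hlo : ∀ j : ℕ, ∃ᶠ n in atTop,
      (1 - 1 / ((j : ℝ) + 1)) * √(2 * ω.A n * loglog (ω.A n)) < ω.T n) :
    limsup (fun n : ℕ => ((ω.T n / √(2 * ω.A n * loglog (ω.A n)) : ℝ) : EReal)) atTop = 1 := by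
  have hpos : ∀ᶠ n in atTop, 0 < √(2 * ω.A n * loglog (ω.A n)) := by
    filter_upwards [hA.eventually_ge_atTop (Real.exp (Real.exp 1))] with n hn
    have := one_le_loglog hn
    have := pos_of_exp_le hn
    positivity
  have hc : ∀ ε : ℝ, 0 < ε → ∃ j : ℕ, 1 / ((j : ℝ) + 1) < ε := fun ε hε =>
    exists_nat_one_div_lt hε
  apply le_antisymm
  · refine EReal.le_of_forall_lt_iff_le.1 fun z hz => ?_
    obtain ⟨j, hj⟩ := hc (z - 1) (by
      have : (1 : ℝ) < z := by exact_mod_cast hz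
      linarith)
    refine limsup_le_of_le (by isBoundedDefault) ?_
    filter_upwards [hpos, hup j] with n h1 h2
    rw [EReal.coe_le_coe_iff, div_le_iff₀ h1]
    refine h2.trans ?_
    gcongr
    linarith
  · refine EReal.ge_of_forall_gt_iff_ge.1 fun z hz => ?_
    obtain ⟨j, hj⟩ := hc (1 - z) (by
      have : z < (1 : ℝ) := by exact_mod_cast hz
      linarith)
    refine le_limsup_of_frequently_le ?_ (by isBoundedDefault)
    refine ((hlo j).and_eventually hpos).mono fun n ⟨h1, h2⟩ => ?_
    rw [EReal.coe_le_coe_iff, le_div_iff₀ h2]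
    refine le_trans ?_ h1.le
    gcongr
    linarith

end UFQSH

end

theorem mainTheorem1 (h : ℝ → ℝ) (hh : UFQSH.IsExtraHedge h) :
    UFQSH.SkepticCanForce h
      {ω : UFQSH.Path |
        (Tendsto ω.A atTop atTop ∧
          Summable (fun n : ℕ => (ω.forecast n).w / h (ω.b (n + 1)))) →
        limsup (fun n : ℕ =>
          (((ω.S n - ∑ i ∈ Finset.range n, (ω.forecast i).m) /
            √(2 * ω.A n * Real.log (Real.log (ω.A n))) : ℝ) : EReal)) atTop = 1} := by
  have hj : ∀ j : ℕ, 0 < 1 / ((j : ℝ) + 1) ∧ 1 / ((j : ℝ) + 1) ≤ 1 := fun j =>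
    ⟨by positivity, (div_le_one (by positivity)).2 (by linarith [(Nat.cast_nonneg j : (0 : ℝ) ≤ j)])⟩
  have h1 := UFQSH.forceable_summable_hedgePayoff hh
  have h2 := UFQSH.Forceable.iInter fun j : ℕ =>
    UFQSH.forceable_upper h (hj j).1 (hj j).2 (abs_one : |(1 : ℝ)| = 1)
  -- The crude bound with constant `2` for the negated deviations, needed at the block starts of the
  -- lower bound.
  have h3 := UFQSH.forceable_upper h one_pos le_rfl (by simp : |(-1 : ℝ)| = 1)
  have h4 := UFQSH.Forceable.iInter fun j : ℕ => UFQSH.forceable_lower hh (hj j).1 (hj j).2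
  refine (h1.inter (h2.inter (h3.inter h4))).skepticCanForce ?_
  rintro ω ⟨g1, g2, g3, g4⟩ hc ⟨hA, hz⟩
  rw [Set.mem_iInter] at g2 g4
  have he := UFQSH.summable_err hh hA hc hz (g1 hz)
  have g3' : ∀ᶠ n in atTop, -ω.T n ≤ 2 * √(2 * ω.A n * UFQSH.loglog (ω.A n)) := by
    filter_upwards [g3 hA he] with n hn
    linarith
  simp_rw [← ω.T_eq]
  refine UFQSH.limsup_eq_one hA (fun j => ?_) fun j => g4 j hA hz he g3'
  filter_upwards [g2 j hA he] with n hn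
  linarith
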